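/- Let $r,k\ge 0$ be integers and let $\beta=(\beta_1,\dots,\beta_m)$ be a sequence of non-negative integers (a weak composition). Let $\mathcal{OP}_{r;\beta,k}$ be the set of all sequences $\pi=B_1/\cdots/B_k$ of $k$ non-empty sets (blocks) of integers in $\{0,1,\dots,m\}$ such that $0$ lies in exactly $r$ of the blocks, each $i\in\{1,\dots,m\}$ lies in exactly $\beta_i$ of the blocks, and $0\notin B_k$ (no condition if $k=0$); these are the extended ordered multiset partitions of $\{0^r\}\cup\{i^{\beta_i}:1\le i\le m\}$ into $k$ blocks. Write $B_i^h$ for the $h$-th smallest element of $B_i$; a condition on $B_i^h$ includes that this element exists. For $\pi\in\mathcal{OP}_{r;\beta,k}$ define the following four statistics. - $\mathrm{inv}(\pi)$ is the number of pairs consisting of an entry $a$ of some block $B_i$ and the minimum $b$ of some block $B_j$ with $i<j$ and $a>b$ (entries are counted as occurrences, not only by their values). - $\mathrm{dinv}(\pi)=|\{(h,i,j): i<j,\ B_i^h>B_j^h\}|+|\{(h,i,j): i<j,\ B_i^h<B_j^{h+1}\}|$. - Let $\sigma=\sigma_1\sigma_2\cdots$ be the word obtained by writing the blocks $B_1,\dots,B_k$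 one after the other, each in decreasing order, and let $\mathrm{ind}(\pi)$ be the word $0^{|B_1|}1^{|B_2|}\cdots(k-1)^{|B_k|}$. Then $\mathrm{maj}(\pi)=\sum_{i:\,\sigma_i>\sigma_{i+1}}\mathrm{ind}(\pi)_{i+1}$. - $\mathrm{miniword}(\pi)$ is the word built as follows from right to left: write $B_k$ in increasing order; once $B_{i+1}$ has been arranged and its arrangement starts with the letter $c$, arrange $B_i$ by writing its elements $>c$ in increasing order followed by its elements $\le c$ in increasing order, and place this to the left of what has been written. If $w=w_1w_2\cdots$ is the resulting word, then $\mathrm{minimaj}(\pi)=\sum_{i:\,w_i>w_{i+1}} i$. For each of these statistics put $$D^{\mathrm{stat}}_{r;\beta,k}(q)=\sum_{\pi\in\mathcal{OP}_{r;\beta,k}}q^{\mathrm{stat}(\pi)}.$$ Then $$D^{\mathrm{inv}}_{r;\beta,k}(q)=D^{\mathrm{maj}}_{r;\beta,k}(q)=D^{\mathrm{dinv}}_{r;\beta,k}(q)=D^{\mathrm{minimaj}}_{r;\beta,k}(q).$$ -/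

import Mathlib

namespace OMP

/-- The entries of the partitions are the letters `0, 1, …, m`, that is, the elements of
`Fin (m + 1)`. The multiset `{0^r} ∪ {i^{β_i} : 1 ≤ i ≤ m}` is given by its multiplicity
function: the letter `0` occurs `r` times and the letter `i` occurs `β_i` times (the composition
`β_1, …, β_m` is indexed by `Fin m`, starting from `0`). -/
def content {m : ℕ} (r : ℕ) (β : Fin m → ℕ) : Fin (m + 1) → ℕ :=
  Fin.cons r β

/-- `B_1 / ⋯ / B_k` is an ordered multiset partition with content `γ`: the blocks are non-empty
sets (no repetition inside a block), and every letter `a` lies in exactly `γ a` of them. -/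
def IsOrderedMultisetPartition {m k : ℕ} (γ : Fin (m + 1) → ℕ)
    (B : Fin k → Finset (Fin (m + 1))) : Prop :=
  (∀ i, (B i).Nonempty) ∧ ∀ a, (Finset.univ.filter fun i => a ∈ B i).card = γ a

instance {m k : ℕ} (γ : Fin (m + 1) → ℕ) :
    DecidablePred (IsOrderedMultisetPartition (k := k) γ) := fun B => by
  unfold IsOrderedMultisetPartition
  infer_instance

/-- The extended ordered multiset partitions `OP_{r;β,k}`: the ordered multiset partitions of
`{0^r} ∪ {i^{β_i}}` into `k` blocks such that `0` is not contained in the last block. -/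
def extendedOP {m : ℕ} (r : ℕ) (β : Fin m → ℕ) (k : ℕ) :
    Finset (Fin k → Finset (Fin (m + 1))) :=
  Finset.univ.filter fun B =>
    IsOrderedMultisetPartition (content r β) B ∧ ∀ i : Fin k, (i : ℕ) + 1 = k → 0 ∉ B i

/-- The inversion statistic: the number of pairs formed by an entry `a` of a block `B_i` and the
minimum `b` of a block `B_j` with `i < j` and `a > b` (`p = (i, a, j, b)`). -/
def inv {m k : ℕ} (B : Fin k → Finset (Fin (m + 1))) : ℕ :=
  (Finset.univ.filter fun p : Fin k × Fin (m + 1) × Fin k × Fin (m + 1) =>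
    p.1 < p.2.2.1 ∧ p.2.1 ∈ B p.1 ∧
      (p.2.2.2 ∈ B p.2.2.1 ∧ ∀ c ∈ B p.2.2.1, p.2.2.2 ≤ c) ∧ p.2.2.2 < p.2.1).card

/-- `x` is the `h`-th smallest element of `S` (counting from `h = 1`). -/
def IsNthSmallest {α : Type*} [LinearOrder α] (S : Finset α) (h : ℕ) (x : α) : Prop :=
  x ∈ S ∧ (S.filter fun y => y < x).card + 1 = h

instance {α : Type*} [LinearOrder α] (S : Finset α) (h : ℕ) (x : α) :
    Decidable (IsNthSmallest S h x) := by
  unfold IsNthSmallest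
  infer_instance

/-- Primary diagonal inversions: triples `(h, i, j)` with `i < j` and `B_i^h > B_j^h`, both
entries existing. A block has at most `m + 1` elements, so `1 ≤ h ≤ m + 1` is no restriction. -/
def primaryDinvs {m k : ℕ} (B : Fin k → Finset (Fin (m + 1))) : Finset (ℕ × Fin k × Fin k) :=
  (Finset.Icc 1 (m + 1) ×ˢ Finset.univ).filter fun t => t.2.1 < t.2.2 ∧
    ∃ x y, IsNthSmallest (B t.2.1) t.1 x ∧ IsNthSmallest (B t.2.2) t.1 y ∧ y < x

/-- Secondary diagonal inversions: triples `(h, i, j)` with `i < j` and `B_i^h < B_j^{h+1}`, both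
entries existing. -/
def secondaryDinvs {m k : ℕ} (B : Fin k → Finset (Fin (m + 1))) : Finset (ℕ × Fin k × Fin k) :=
  (Finset.Icc 1 (m + 1) ×ˢ Finset.univ).filter fun t => t.2.1 < t.2.2 ∧
    ∃ x y, IsNthSmallest (B t.2.1) t.1 x ∧ IsNthSmallest (B t.2.2) (t.1 + 1) y ∧ x < y

/-- The diagonal inversion statistic: the number of primary plus the number of secondary
diagonal inversions. -/
def dinv {m k : ℕ} (B : Fin k → Finset (Fin (m + 1))) : ℕ :=
  (primaryDinvs B).card + (secondaryDinvs B).card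

/-- The descents of a word, as positions counted from `0`: `i` is a descent of `w_0 w_1 ⋯` if
`w_i > w_{i+1}`. -/
def descents {α : Type*} [LinearOrder α] (w : List α) : Finset ℕ :=
  (Finset.range w.length).filter fun i =>
    ∃ h : i + 1 < w.length, w[i + 1] < w[i]

/-- The major index of a word: the sum of its descents, counted from `1`. -/
def wordMaj {α : Type*} [LinearOrder α] (w : List α) : ℕ :=
  ∑ i ∈ descents w, (i + 1)

/-- The word `σ(π)`: each block is written in decreasing order. -/
def sigmaWord {m k : ℕ} (B : Fin k → Finset (Fin (m + 1))) : List (Fin (m + 1)) :=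
  (List.ofFn fun i => (B i).sort (· ≥ ·)).flatten

/-- The index word `0^{|B_1|} 1^{|B_2|} ⋯ (k-1)^{|B_k|}`. -/
def indexWord {m k : ℕ} (B : Fin k → Finset (Fin (m + 1))) : List ℕ :=
  (List.ofFn fun i : Fin k => List.replicate (B i).card (i : ℕ)).flatten

/-- The major index of an ordered multiset partition: the sum, over the descents
`σ_i > σ_{i+1}` of `σ(π)`, of the `(i+1)`-st letter of the index word. -/
def maj {m k : ℕ} (B : Fin k → Finset (Fin (m + 1))) : ℕ :=
  ∑ i ∈ descents (sigmaWord B), (indexWord B).getD (i + 1) 0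

/-- The miniword of a list of blocks, built from the right: the last block is written in
increasing order; any other block is written with its elements bigger than the first letter `c`
of the next block's arrangement first, in increasing order, followed by its remaining elements
in increasing order. -/
def miniwordList {α : Type*} [LinearOrder α] : List (Finset α) → List α
  | [] => []
  | S :: L =>
    match (miniwordList L).head? with
    | none => S.sort (· ≤ ·)
    | some c =>
      (S.filter fun x => c < x).sort (· ≤ ·) ++ (S.filter fun x => x ≤ c).sort (· ≤ ·) ++
        miniwordList L

/-- The word `miniword(π)`. -/
def miniword {m k : ℕ} (B : Fin k → Finset (Fin (m + 1))) : List (Fin (m + 1)) :=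
  miniwordList (List.ofFn B)

/-- The minimum major index: the major index of the miniword. -/
def minimaj {m k : ℕ} (B : Fin k → Finset (Fin (m + 1))) : ℕ :=
  wordMaj (miniword B)

/-- The generating function `D_{r;β,k}^{stat}(q)`, a polynomial in `q`. -/
noncomputable def genFun {m k : ℕ} (r : ℕ) (β : Fin m → ℕ)
    (stat : (Fin k → Finset (Fin (m + 1))) → ℕ) : Polynomial ℤ :=
  ∑ B ∈ extendedOP r β k, Polynomial.X ^ stat B

end OMP

/-! Fix `q`, give each letter `a` a variable `x a`, and pair the generating functions over sequences
of `k` non-empty blocks with `e_k(1, q, …, q^(N-1))`, summing over `k`. The result is a product: for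
each of the four statistics, with the last block restricted to avoid `0`, the pairing times `q^N`
equals `boxProd q N x * (∏_{a ≠ 0} (1 + q^N x_a) - 1)`. The matrix `qEsymm q N k` is triangular with
non-zero diagonal, so these identities for all `N` determine the generating functions
(`eq_of_qEsymmSum_eq`). Comparing coefficients of a monomial then fixes the content
(`coeff_extendedGF`).

For `inv`, `minimaj` and `maj` a finer formula holds, with the minimum `c` of the last block
prescribed (`HasLastMinFormula`). For `inv` and `minimaj`, deleting that block lowers the statistic
by the number of remaining entries above `c`, up to a permutation of the letters, which is harmless
because `boxProd` is symmetric (`hasLastMinFormula_of_relabelling`). For `minimaj` the permutation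
is the cyclic rotation making `c` the largest letter (`wordMaj_rotate`). For `maj`, deleting the
smallest entry of the last block gives a recursion in `c`, solved from the largest letter down.

For `dinv`, empty blocks are allowed: `e_k(1, q, …, q^(N-1))` records the positions of the `k`
non-empty blocks among `N`. Letters are inserted in increasing order. Putting a new largest letter
into block `j` raises `dinv` plus the position sum by a rank of `j`, and these ranks permute `0, …,
N-1` (`dinv_insertLetter`, `prod_sizeRank`), so each letter contributes one product. -/

namespace OMP

open Finset

/-! ### Principal specialisations of elementary symmetric polynomials and product identities. -/

section Algebra

variable {R : Type*} [CommRing R]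

/-- The elementary symmetric polynomial `e_k(1, q, …, q^(N-1)) = q^(k choose 2) [N choose k]_q`. -/
def qEsymm (q : R) : ℕ → ℕ → R
  | _, 0 => 1
  | 0, _ + 1 => 0
  | N + 1, k + 1 => qEsymm q N (k + 1) + q ^ N * qEsymm q N k

@[simp]
theorem qEsymm_zero_right (q : R) (N : ℕ) : qEsymm q N 0 = 1 := by
  cases N <;> rfl

theorem qEsymm_succ_succ (q : R) (N k : ℕ) :
    qEsymm q (N + 1) (k + 1) = qEsymm q N (k + 1) + q ^ N * qEsymm q N k := rfl

theorem qEsymm_eq_zero_of_lt (q : R) {N k : ℕ} (h : N < k) : qEsymm q N k = 0 := by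
  induction N generalizing k with
  | zero => obtain ⟨k, rfl⟩ := Nat.exists_eq_succ_of_ne_zero h.ne'; rfl
  | succ N ih =>
    obtain ⟨k, rfl⟩ := Nat.exists_eq_succ_of_ne_zero (Nat.ne_zero_of_lt h)
    rw [Nat.succ_eq_add_one, qEsymm_succ_succ, ih (by omega), ih (by omega)]
    ring

theorem qEsymm_self_ne_zero [IsDomain R] {q : R} (hq : q ≠ 0) (N : ℕ) : qEsymm q N N ≠ 0 := by
  induction N with
  | zero => simp
  | succ N ih =>
    rw [qEsymm_succ_succ, qEsymm_eq_zero_of_lt q (Nat.lt_succ_self N), zero_add]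
    exact mul_ne_zero (pow_ne_zero _ hq) ih

/-- Splits off the variable `1` instead of `q^N`; the remaining variables are `q` times `1, …,
q^(N-1)`, which explains the powers of `q`. -/
theorem qEsymm_succ_succ' (q : R) (N k : ℕ) :
    qEsymm q (N + 1) (k + 1) = q ^ (k + 1) * qEsymm q N (k + 1) + q ^ k * qEsymm q N k := by
  induction N generalizing k with
  | zero =>
    cases k with
    | zero => simp [qEsymm]
    | succ k => simp [qEsymm]
  | succ N ih =>
    rw [qEsymm_succ_succ]
    have h₁ := (qEsymm_succ_succ q N k).symm.trans (ih k)
    cases k with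
    | zero =>
      rw [ih]
      simp only [qEsymm_zero_right] at h₁ ⊢
      linear_combination q * h₁
    | succ k =>
      have h₂ := (qEsymm_succ_succ q N k).symm.trans (ih k)
      rw [ih, ih]
      linear_combination q ^ (k + 2) * h₁ + q ^ (k + 1) * h₂

/-- The pairing of a sequence with `k ↦ e_k(1, q, …, q^(N-1))`. -/
def qEsymmSum (q : R) (N : ℕ) (f : ℕ → R) : R :=
  ∑ k ∈ range (N + 1), qEsymm q N k * f k

theorem qEsymmSum_eq (q : R) {N M : ℕ} (h : N ≤ M) (f : ℕ → R) :
    qEsymmSum q N f = ∑ k ∈ range (M + 1), qEsymm q N k * f k := by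
  refine sum_subset (by simpa using h) fun k _ hk => ?_
  rw [qEsymm_eq_zero_of_lt q (by simpa [Nat.lt_succ_iff] using hk), zero_mul]

@[simp]
theorem qEsymmSum_zero (q : R) (f : ℕ → R) : qEsymmSum q 0 f = f 0 := by
  simp [qEsymmSum]

theorem qEsymmSum_add (q : R) (N : ℕ) (f g : ℕ → R) :
    qEsymmSum q N (fun k => f k + g k) = qEsymmSum q N f + qEsymmSum q N g := by
  simp [qEsymmSum, mul_add, sum_add_distrib]

theorem qEsymmSum_sub (q : R) (N : ℕ) (f g : ℕ → R) :
    qEsymmSum q N (fun k => f k - g k) = qEsymmSum q N f - qEsymmSum q N g := by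
  simp [qEsymmSum, mul_sub, sum_sub_distrib]

theorem qEsymmSum_mul_left (q : R) (N : ℕ) (a : R) (f : ℕ → R) :
    qEsymmSum q N (fun k => a * f k) = a * qEsymmSum q N f := by
  simp only [qEsymmSum, mul_sum]
  exact sum_congr rfl fun k _ => by ring

theorem qEsymmSum_sum {ι : Type*} (q : R) (N : ℕ) (s : Finset ι) (f : ι → ℕ → R) :
    qEsymmSum q N (fun k => ∑ i ∈ s, f i k) = ∑ i ∈ s, qEsymmSum q N (f i) := by
  simp only [qEsymmSum, mul_sum]
  rw [sum_comm]

theorem qEsymmSum_succ (q : R) (N : ℕ) (f : ℕ → R) :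
    qEsymmSum q (N + 1) f =
      qEsymmSum q N f + q ^ N * qEsymmSum q N (fun k => f (k + 1)) := by
  rw [qEsymmSum_eq q (Nat.le_succ N) f, qEsymmSum, sum_range_succ', sum_range_succ' _ (N + 1)]
  simp only [qEsymm_succ_succ, qEsymm_zero_right, add_mul, sum_add_distrib, qEsymmSum, mul_sum,
    mul_assoc]
  ring

theorem qEsymmSum_succ' (q : R) (N : ℕ) (f : ℕ → R) :
    qEsymmSum q (N + 1) f =
      qEsymmSum q N (fun k => q ^ k * f k) + qEsymmSum q N (fun k => q ^ k * f (k + 1)) := by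
  rw [qEsymmSum_eq q (Nat.le_succ N) (fun k => q ^ k * f k), qEsymmSum, sum_range_succ',
    sum_range_succ' _ (N + 1)]
  simp only [qEsymm_succ_succ', qEsymm_zero_right, add_mul, sum_add_distrib, qEsymmSum, pow_zero,
    one_mul]
  rw [add_right_comm]
  congr 1
  · congr 1
    exact sum_congr rfl fun k _ => by ring
  · exact sum_congr rfl fun k _ => by ring

/-- The pairings form a triangular system in `f 0, f 1, …` whose diagonal entries `qEsymm q N N` are
non-zero. -/
theorem eq_of_qEsymmSum_eq [IsDomain R] {q : R} (hq : q ≠ 0) {f g : ℕ → R}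
    (h : ∀ N, qEsymmSum q N f = qEsymmSum q N g) : f = g := by
  funext N
  induction N using Nat.strong_induction_on with
  | _ N ih =>
    have hN := h N
    rw [qEsymmSum, qEsymmSum, sum_range_succ, sum_range_succ,
      sum_congr rfl fun k hk => by rw [ih k (mem_range.1 hk)]] at hN
    exact mul_left_cancel₀ (qEsymm_self_ne_zero hq N) (add_left_cancel hN)

/-- The product of `1 + q^p x_a` over all letters `a` and all `p < N`. -/
def boxProd {α : Type*} [Fintype α] (q : R) (N : ℕ) (x : α → R) : R :=
  ∏ a, ∏ p ∈ range N, (1 + q ^ p * x a)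

theorem boxProd_succ {α : Type*} [Fintype α] (q : R) (N : ℕ) (x : α → R) :
    boxProd q (N + 1) x = boxProd q N x * ∏ a, (1 + q ^ N * x a) := by
  simp only [boxProd, prod_range_succ, prod_mul_distrib]

theorem boxProd_comp_equiv {α : Type*} [Fintype α] (q : R) (N : ℕ) (x : α → R)
    (e : Equiv.Perm α) : boxProd q N (fun a => x (e a)) = boxProd q N x :=
  Equiv.prod_comp e fun a => ∏ p ∈ range N, (1 + q ^ p * x a)

/-- Expanding the right-hand product gives the non-empty subsets of `U`, grouped on the left by
their minimum `c`. As `U` is closed upwards, all letters above `c` are available. -/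
theorem sum_mul_prod_Ioi {α : Type*} [Fintype α] [LinearOrder α] [LocallyFiniteOrderTop α]
    (U : Finset α) (hU : ∀ c ∈ U, ∀ a, c < a → a ∈ U) (y : α → R) :
    ∑ c ∈ U, y c * ∏ a ∈ Ioi c, (1 + y a) = ∏ a ∈ U, (1 + y a) - 1 := by
  have h := prod_sub_ordered U (fun a => 1 + y a) y
  simp only [add_sub_cancel_right, prod_const_one, mul_one] at h
  rw [eq_sub_iff_add_eq] at h
  rw [eq_sub_iff_add_eq', ← h]
  congr 1
  refine sum_congr rfl fun c hc => ?_
  congr 1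
  refine prod_congr ?_ fun _ _ => rfl
  ext a
  simp only [mem_Ioi, mem_filter]
  exact ⟨fun h => ⟨hU c hc a h, h⟩, fun h => h.2⟩

/-- For `a > c` the exponents on the left are `1, …, N` together with the extra `0`; on the right
they are `0, …, N-1` together with `N`. -/
theorem boxProd_mul_ite {α : Type*} [Fintype α] [LinearOrder α] [LocallyFiniteOrderTop α]
    (q : R) (N : ℕ) (x : α → R) (c : α) :
    (∏ a ∈ Ioi c, (1 + x a)) * boxProd q N (fun a => if c < a then q * x a else x a) =
      boxProd q N x * ∏ a ∈ Ioi c, (1 + q ^ N * x a) := by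
  have h : ∀ f : α → R, ∏ a ∈ Ioi c, f a = ∏ a, if c < a then f a else 1 := fun f => by
    rw [← prod_filter]
    exact prod_congr (by ext; simp) fun _ _ => rfl
  rw [h, h, boxProd, boxProd, ← prod_mul_distrib, ← prod_mul_distrib]
  refine prod_congr rfl fun a _ => ?_
  split_ifs
  · rw [← prod_range_succ fun p => 1 + q ^ p * x a, prod_range_succ' fun p => 1 + q ^ p * x a,
      mul_comm]
    simp only [pow_succ, pow_zero, one_mul, mul_assoc]
  · simp

end Algebra

/-! ### Sequences of non-empty blocks and their monomials. -/

section Tuples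

/-- The sequences of `k` non-empty blocks. -/
def nonemptyTuples (α : Type*) [Fintype α] [DecidableEq α] (k : ℕ) :
    Finset (Fin k → Finset α) :=
  Fintype.piFinset fun _ => univ.erase ∅

theorem mem_nonemptyTuples {α : Type*} [Fintype α] [DecidableEq α] {k : ℕ} {B : Fin k → Finset α} :
    B ∈ nonemptyTuples α k ↔ ∀ i, (B i).Nonempty := by
  simp [nonemptyTuples, nonempty_iff_ne_empty]

/-- The sequence of blocks `B` followed by the block `S`. -/
abbrev appendBlock {α : Type*} {k : ℕ} (B : Fin k → Finset α) (S : Finset α) :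
    Fin (k + 1) → Finset α :=
  Fin.snoc (α := fun _ => Finset α) B S

theorem sum_piFinset_appendBlock {α M : Type*} [AddCommMonoid M] {k : ℕ} (X : Finset (Finset α))
    (φ : (Fin (k + 1) → Finset α) → M) :
    ∑ B ∈ Fintype.piFinset (fun _ : Fin (k + 1) => X), φ B =
      ∑ S ∈ X, ∑ B ∈ Fintype.piFinset (fun _ : Fin k => X), φ (appendBlock B S) := by
  rw [← sum_product']
  refine (sum_nbij' (fun p => appendBlock p.2 p.1)
    (fun B => (B (Fin.last k), fun i => B i.castSucc)) ?_ ?_ ?_ ?_ ?_).symm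
  · rintro ⟨S, B⟩ h
    simp only [mem_product, Fintype.mem_piFinset] at h ⊢
    intro i
    induction i using Fin.lastCases with
    | last => simpa using h.1
    | cast i => simpa using h.2 i
  · intro B h
    simp only [mem_product, Fintype.mem_piFinset] at h ⊢
    exact ⟨h _, fun i => h _⟩
  · rintro ⟨S, B⟩ _
    simp
  · intro B _
    exact Fin.snoc_init_self (α := fun _ => Finset α) B
  · intros
    rfl

theorem sum_powerset_erase_empty {α : Type*} [Fintype α] [LinearOrder α]
    [LocallyFiniteOrderTop α] {M : Type*} [AddCommMonoid M] (U : Finset α)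
    (hU : ∀ c ∈ U, ∀ a, c < a → a ∈ U) (φ : Finset α → M) :
    ∑ S ∈ U.powerset.erase ∅, φ S = ∑ c ∈ U, ∑ T ∈ (Ioi c).powerset, φ (insert c T) := by
  rw [sum_sigma']
  symm
  refine sum_bij' (fun p _ => insert p.1 p.2)
    (fun S hS => ⟨S.min' (nonempty_iff_ne_empty.2 (ne_of_mem_erase hS)),
      S.erase (S.min' (nonempty_iff_ne_empty.2 (ne_of_mem_erase hS)))⟩)
    ?_ ?_ ?_ ?_ ?_
  · rintro ⟨c, T⟩ h
    simp only [mem_sigma, mem_powerset] at h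
    simp only [mem_erase, ne_eq, insert_ne_empty, not_false_eq_true, true_and, mem_powerset,
      insert_subset_iff]
    exact ⟨h.1, fun a ha => hU c h.1 a (mem_Ioi.1 (h.2 ha))⟩
  · intro S hS
    simp only [mem_sigma, mem_powerset]
    refine ⟨mem_powerset.1 (mem_of_mem_erase hS) (min'_mem _ _), fun a ha => ?_⟩
    exact mem_Ioi.2 (lt_of_le_of_ne (min'_le _ _ (mem_of_mem_erase ha)) (ne_of_mem_erase ha).symm)
  · rintro ⟨c, T⟩ h
    simp only [mem_sigma, mem_powerset] at h
    have hc : (insert c T).min' (insert_nonempty c T) = c :=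
      le_antisymm (min'_le _ _ (mem_insert_self _ _)) <| le_min' _ _ _ fun a ha => by
        rcases mem_insert.1 ha with rfl | ha
        · exact le_rfl
        · exact (mem_Ioi.1 (h.2 ha)).le
    have hT : c ∉ T := fun hcT => lt_irrefl c (mem_Ioi.1 (h.2 hcT))
    simp [hc, erase_insert hT]
  · intro S hS
    exact insert_erase (min'_mem S (nonempty_iff_ne_empty.2 (ne_of_mem_erase hS)))
  · intros
    rfl

variable {α R : Type*} [CommRing R]

/-- The monomial `∏_i ∏_{a ∈ B_i} x_a`. -/
def weight {k : ℕ} (x : α → R) (B : Fin k → Finset α) : R :=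
  ∏ i, ∏ a ∈ B i, x a

theorem weight_appendBlock {k : ℕ} (x : α → R) (B : Fin k → Finset α) (S : Finset α) :
    weight x (appendBlock B S) = weight x B * ∏ a ∈ S, x a := by
  simp [weight, Fin.prod_univ_castSucc]

end Tuples

/-! ### Generating functions refined by the minimum of the last block. -/

section GeneratingFunctions

variable {α : Type*} [Fintype α] [LinearOrder α] [LocallyFiniteOrderTop α]
variable {R : Type*} [CommRing R]

/-- The generating function of a statistic over all sequences of `k` non-empty blocks. -/
def tupleGF {α : Type*} [Fintype α] [DecidableEq α] (q : R) (x : α → R)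
    (stat : ∀ k, (Fin k → Finset α) → ℕ) (k : ℕ) : R :=
  ∑ B ∈ nonemptyTuples α k, q ^ stat k B * weight x B

/-- The generating function of a statistic over all sequences of `k + 1` non-empty blocks whose
last block has minimum `c`. -/
def lastMinGF (q : R) (x : α → R) (stat : ∀ k, (Fin k → Finset α) → ℕ) (k : ℕ) (c : α) : R :=
  ∑ B ∈ nonemptyTuples α k, ∑ T ∈ (Ioi c).powerset,
    q ^ stat (k + 1) (appendBlock B (insert c T)) * weight x (appendBlock B (insert c T))

theorem tupleGF_succ (q : R) (x : α → R) (stat : ∀ k, (Fin k → Finset α) → ℕ) (k : ℕ) :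
    tupleGF q x stat (k + 1) = ∑ c, lastMinGF q x stat k c := by
  rw [tupleGF, nonemptyTuples, sum_piFinset_appendBlock, ← powerset_univ,
    sum_powerset_erase_empty univ (by simp)]
  refine sum_congr rfl fun c _ => ?_
  rw [lastMinGF, sum_comm]
  rfl

theorem tupleGF_zero {α : Type*} [Fintype α] [DecidableEq α] (q : R) (x : α → R)
    {stat : ∀ k, (Fin k → Finset α) → ℕ}
    (h0 : ∀ B, stat 0 B = 0) : tupleGF q x stat 0 = 1 := by
  simp [tupleGF, nonemptyTuples, h0, weight]

/-- The generating function over sequences whose last block has minimum `c` has the product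
formula shared by the statistics `inv`, `maj` and `minimaj`. -/
def HasLastMinFormula (q : R) (stat : ∀ k, (Fin k → Finset α) → ℕ) : Prop :=
  ∀ (x : α → R) (N : ℕ) (c : α), qEsymmSum q N (fun k => lastMinGF q x stat k c) =
    boxProd q N x * (x c * ∏ a ∈ Ioi c, (1 + q ^ N * x a))

/-- Used with `U` the full alphabet for the induction on `N`, and with `U` the non-zero letters for
the condition on the last block. -/
theorem pow_mul_qEsymmSum_sum {q : R} {N : ℕ} {x : α → R} {h : ℕ → α → R}
    (H : ∀ c, qEsymmSum q N (fun k => h k c) =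
      boxProd q N x * (x c * ∏ a ∈ Ioi c, (1 + q ^ N * x a)))
    (U : Finset α) (hU : ∀ c ∈ U, ∀ a, c < a → a ∈ U) :
    q ^ N * qEsymmSum q N (fun k => ∑ c ∈ U, h k c) =
      boxProd q N x * (∏ a ∈ U, (1 + q ^ N * x a) - 1) := by
  rw [qEsymmSum_sum, ← sum_mul_prod_Ioi U hU fun a => q ^ N * x a, mul_sum, mul_sum]
  refine sum_congr rfl fun c _ => ?_
  rw [H]
  ring

/-- The product formula follows if it can be derived, for each `N`, from the product formula for
the generating functions of all sequences. -/
theorem hasLastMinFormula_of_step {q : R} {stat : ∀ k, (Fin k → Finset α) → ℕ}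
    (h0 : ∀ B, stat 0 B = 0)
    (step : ∀ N, (∀ x : α → R, qEsymmSum q N (tupleGF q x stat) = boxProd q N x) →
      ∀ (x : α → R) (c : α), qEsymmSum q N (fun k => lastMinGF q x stat k c) =
        boxProd q N x * (x c * ∏ a ∈ Ioi c, (1 + q ^ N * x a))) :
    HasLastMinFormula q stat := by
  -- The induction keeps `x` general, since deleting the last block may rescale and permute the
  -- variables.
  suffices H : ∀ N, ∀ x : α → R, qEsymmSum q N (tupleGF q x stat) = boxProd q N x from
    fun x N => step N (H N) x
  intro N
  induction N with
  | zero => intro x; simp [tupleGF_zero q x h0, boxProd]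
  | succ N ih =>
    intro x
    simp only [qEsymmSum_succ, tupleGF_succ]
    rw [pow_mul_qEsymmSum_sum (step N ih x) univ (by simp), ih, boxProd_succ]
    ring

end GeneratingFunctions

/-! ### Statistics that lose the number of larger entries when the last block is deleted. -/

section Relabelling

variable {R : Type*} [CommRing R]

theorem sum_nonemptyTuples_image {α : Type*} [Fintype α] [DecidableEq α] {M : Type*}
    [AddCommMonoid M] {k : ℕ} (e : Equiv.Perm α) (φ : (Fin k → Finset α) → M) :
    ∑ B ∈ nonemptyTuples α k, φ (fun i => (B i).image e) = ∑ B ∈ nonemptyTuples α k, φ B := by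
  refine sum_nbij' (fun B i => (B i).image e) (fun B i => (B i).image e.symm) ?_ ?_ ?_ ?_ ?_
  · simp [mem_nonemptyTuples]
  · simp [mem_nonemptyTuples]
  · intro B _
    funext i
    simp [image_image]
  · intro B _
    funext i
    simp [image_image]
  · intros
    rfl

/-- The last block contributes `x c * ∏_{a > c} (1 + x a)` freely, and the others form an arbitrary
sequence with `x a` replaced by `q * x a` for `a > c`, permuted by `e c`. Symmetry of `boxProd`
removes the permutation and `boxProd_mul_ite` rearranges the factors. -/
theorem hasLastMinFormula_of_relabelling {α : Type*} [Fintype α] [LinearOrder α]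
    [LocallyFiniteOrderTop α] (q : R) {stat : ∀ k, (Fin k → Finset α) → ℕ}
    (h0 : ∀ B, stat 0 B = 0) (e : α → Equiv.Perm α)
    (hs : ∀ k (B : Fin k → Finset α) c, ∀ T ⊆ Ioi c, (∀ i, (B i).Nonempty) →
      stat (k + 1) (appendBlock B (insert c T)) =
        stat k (fun i => (B i).image (e c)) + ∑ i, ((B i).filter (c < ·)).card) :
    HasLastMinFormula q stat := by
  refine hasLastMinFormula_of_step h0 fun N H x c => ?_
  set y : α → R := fun a => if c < a then q * x a else x a
  have key : ∀ k, lastMinGF q x stat k c =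
      (x c * ∏ a ∈ Ioi c, (1 + x a)) * tupleGF q (fun a => y ((e c).symm a)) stat k := by
    intro k
    rw [tupleGF, ← sum_nonemptyTuples_image (e c), lastMinGF, prod_one_add, mul_sum (Ioi c).powerset,
      sum_mul_sum, sum_comm]
    refine sum_congr rfl fun T hT => sum_congr rfl fun B hB => ?_
    have hcT : c ∉ T := fun h => lt_irrefl c (mem_Ioi.1 (mem_powerset.1 hT h))
    rw [hs k B c T (mem_powerset.1 hT) (mem_nonemptyTuples.1 hB), weight_appendBlock,
      prod_insert hcT]
    have hw : weight (fun a => y ((e c).symm a)) (fun i => (B i).image (e c)) =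
        q ^ (∑ i, ((B i).filter (c < ·)).card) * weight x B := by
      simp only [weight]
      rw [← prod_pow_eq_pow_sum, ← prod_mul_distrib]
      refine prod_congr rfl fun i _ => ?_
      rw [prod_image (fun _ _ _ _ h => (e c).injective h)]
      simp only [Equiv.symm_apply_apply, y]
      rw [← prod_const, prod_filter, ← prod_mul_distrib]
      exact prod_congr rfl fun a _ => by split_ifs <;> simp
    rw [hw]
    ring
  simp only [key]
  rw [qEsymmSum_mul_left, H, boxProd_comp_equiv q N y (e c).symm, mul_assoc, boxProd_mul_ite]
  ring

end Relabelling

/-! ### The product formula for `inv`. -/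

section Inversions

variable {m : ℕ}

/-- The number of pairs formed by an entry of `A` and the minimum of `S` with the entry of `A`
bigger than the minimum. -/
def minInversions (A S : Finset (Fin (m + 1))) : ℕ :=
  (univ.filter fun p : Fin (m + 1) × Fin (m + 1) =>
    p.1 ∈ A ∧ (p.2 ∈ S ∧ ∀ c ∈ S, p.2 ≤ c) ∧ p.2 < p.1).card

theorem inv_eq_sum {k : ℕ} (B : Fin k → Finset (Fin (m + 1))) :
    inv B = ∑ i, ∑ j, if i < j then minInversions (B i) (B j) else 0 := by
  rw [inv, card_filter, Fintype.sum_prod_type]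
  refine sum_congr rfl fun i _ => ?_
  simp only [Fintype.sum_prod_type, minInversions, card_filter]
  rw [sum_comm]
  refine sum_congr rfl fun j _ => ?_
  split_ifs with h
  · simp [h]
  · simp [h]

theorem minInversions_insert (A : Finset (Fin (m + 1))) {c : Fin (m + 1)}
    {T : Finset (Fin (m + 1))} (hT : T ⊆ Ioi c) :
    minInversions A (insert c T) = (A.filter (c < ·)).card := by
  have hmin : ∀ b, (b ∈ insert c T ∧ ∀ d ∈ insert c T, b ≤ d) ↔ b = c := by
    intro b
    constructor
    · rintro ⟨hb, h⟩
      refine le_antisymm (h c (mem_insert_self _ _)) ?_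
      rcases mem_insert.1 hb with rfl | hb
      · exact le_rfl
      · exact (mem_Ioi.1 (hT hb)).le
    · rintro rfl
      refine ⟨mem_insert_self _ _, fun d hd => ?_⟩
      rcases mem_insert.1 hd with rfl | hd
      · exact le_rfl
      · exact (mem_Ioi.1 (hT hd)).le
  simp only [minInversions, hmin]
  refine card_nbij' (fun p => p.1) (fun a => (a, c)) ?_ ?_ ?_ ?_
  · rintro ⟨a, b⟩ h
    simp only [coe_filter, mem_univ, true_and, Set.mem_ofPred_eq] at h ⊢
    obtain ⟨h₁, rfl, h₂⟩ := h
    exact ⟨h₁, h₂⟩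
  · intro a h
    simpa using h
  · rintro ⟨a, b⟩ h
    simp only [coe_filter, mem_univ, true_and, Set.mem_ofPred_eq] at h
    simp [h.2.1]
  · intro a _
    rfl

theorem inv_appendBlock {k : ℕ} (B : Fin k → Finset (Fin (m + 1))) (S : Finset (Fin (m + 1))) :
    inv (appendBlock B S) = inv B + ∑ i, minInversions (B i) S := by
  simp only [inv_eq_sum]
  rw [Fin.sum_univ_castSucc]
  have hlast : ∀ j : Fin (k + 1), ¬ Fin.last k < j := fun j => (Fin.le_last j).not_gt
  simp only [Fin.sum_univ_castSucc, Fin.snoc_castSucc, Fin.snoc_last, Fin.castSucc_lt_castSucc_iff,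
    Fin.castSucc_lt_last, if_true, hlast, if_false, sum_const_zero, add_zero, sum_add_distrib]

/-- The last block enters `inv` only through its minimum, so no relabelling is needed. -/
theorem hasLastMinFormula_inv {R : Type*} [CommRing R] (q : R) :
    HasLastMinFormula (α := Fin (m + 1)) q fun _ => inv := by
  refine hasLastMinFormula_of_relabelling q ?_ (fun _ => 1) ?_
  · intro B
    simp [inv_eq_sum]
  · intro k B c T hT _
    rw [inv_appendBlock]
    simp [minInversions_insert _ hT]

end Inversions

/-! ### Descents and major index of words under appending letters. -/

section Words

variable {α : Type*} [LinearOrder α]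

theorem mem_descents_iff {w : List α} {i : ℕ} :
    i ∈ descents w ↔ ∃ a ∈ w[i]?, ∃ b ∈ w[i + 1]?, b < a := by
  simp only [descents, mem_filter, mem_range, Option.mem_def, List.getElem?_eq_some_iff]
  constructor
  · rintro ⟨h₁, h₂, h⟩
    exact ⟨_, ⟨h₁, rfl⟩, _, ⟨h₂, rfl⟩, h⟩
  · rintro ⟨_, ⟨h₁, rfl⟩, _, ⟨h₂, rfl⟩, h⟩
    exact ⟨h₁, h₂, h⟩

theorem descents_append_pair (u : List α) (d c : α) :
    descents (u ++ [d] ++ [c]) =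
      if c < d then insert u.length (descents (u ++ [d])) else descents (u ++ [d]) := by
  have key : ∀ i, i ∈ descents (u ++ [d] ++ [c]) ↔
      i ∈ descents (u ++ [d]) ∨ i = u.length ∧ c < d := by
    intro i
    rw [mem_descents_iff, mem_descents_iff]
    rcases lt_trichotomy i u.length with h | rfl | h
    · rw [List.getElem?_append_left (l₁ := u ++ [d]) (by simp; omega),
        List.getElem?_append_left (l₁ := u ++ [d]) (by simp; omega)]
      simp [h.ne]
    · simp
    · rw [List.getElem?_eq_none_iff.2 (show (u ++ [d] ++ [c]).length ≤ i + 1 by simp; omega),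
        List.getElem?_eq_none_iff.2 (show (u ++ [d]).length ≤ i + 1 by simp; omega)]
      simp [h.ne']
  ext i
  rw [key]
  split_ifs with h <;> simp [h, or_comm]

theorem add_one_lt_length_of_mem_descents {w : List α} {i : ℕ} (h : i ∈ descents w) :
    i + 1 < w.length := by
  simp only [descents, mem_filter] at h
  exact h.2.1

@[simp]
theorem descents_singleton (c : α) : descents [c] = ∅ := by
  ext i
  simp [descents]

@[simp]
theorem descents_nil : descents ([] : List α) = ∅ := by
  simp [descents]

theorem sum_descents_append_pair (f : ℕ → ℕ) (u : List α) (d c : α) :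
    ∑ i ∈ descents (u ++ [d] ++ [c]), f i =
      ∑ i ∈ descents (u ++ [d]), f i + if c < d then f u.length else 0 := by
  rw [descents_append_pair]
  split_ifs with h
  · rw [sum_insert, add_comm]
    intro h
    have := add_one_lt_length_of_mem_descents h
    simp at this
  · rfl

theorem wordMaj_append_pair (u : List α) (d c : α) :
    wordMaj (u ++ [d] ++ [c]) = wordMaj (u ++ [d]) + if c < d then u.length + 1 else 0 :=
  sum_descents_append_pair (fun i => i + 1) u d c

theorem wordMaj_append_of_pairwise (w : List α) (c : α) (v : List α)
    (hv : (c :: v).Pairwise (· ≤ ·)) : wordMaj (w ++ c :: v) = wordMaj (w ++ [c]) := by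
  induction v using List.reverseRecOn with
  | nil => rfl
  | append_singleton v d ih =>
    rcases List.eq_nil_or_concat (c :: v) with h | ⟨v', e, h⟩
    · simp at h
    · have hed : ¬ d < e := by
        rw [← List.cons_append, h, List.concat_eq_append, List.append_assoc,
          List.pairwise_append] at hv
        have := hv.2.1
        simp only [List.singleton_append, List.pairwise_cons] at this
        exact not_lt.2 (this.1 d (by simp))
      rw [← ih (by rw [← List.cons_append] at hv; exact (List.pairwise_append.1 hv).1),
        ← List.cons_append, h, List.concat_eq_append]
      have := wordMaj_append_pair (w ++ v') e d
      simpa [hed] using this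

end Words

/-! ### Cyclic rotation of the alphabet. -/

section Rotation

variable {m : ℕ}

/-- The cyclic relabelling of the letters that makes `c` the biggest one. -/
def rotate (c : Fin (m + 1)) : Equiv.Perm (Fin (m + 1)) :=
  Equiv.subRight (c + 1)

theorem rotate_apply (c x : Fin (m + 1)) : rotate c x = x - (c + 1) := rfl

theorem rotate_rotate (c d x : Fin (m + 1)) :
    rotate (rotate c d) (rotate c x) = rotate d x := by
  simp only [rotate_apply]
  abel

theorem val_rotate (c x : Fin (m + 1)) :
    (rotate c x : ℕ) = if c < x then (x : ℕ) - c - 1 else x + m - c := by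
  rw [rotate_apply]
  have hc := c.isLt
  have hx := x.isLt
  rw [Fin.val_sub, Fin.val_add_one]
  simp only [Fin.lt_def, Fin.ext_iff, Fin.val_last]
  split_ifs with h₁ h₂ h₂
  · omega
  · rw [Nat.sub_zero, Nat.add_mod_left, Nat.mod_eq_of_lt hx]
    omega
  · rw [show m + 1 - (c + 1) + x = (x - c - 1) + (m + 1) by omega, Nat.add_mod_right,
      Nat.mod_eq_of_lt (by omega)]
  · rw [Nat.mod_eq_of_lt (by omega)]
    omega

/-- The rotated order is `c+1, …, m, 0, …, c`: letters above `c` precede the others, and each group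
keeps its order. -/
theorem rotate_lt_rotate (c x y : Fin (m + 1)) :
    rotate c x < rotate c y ↔
      if c < x then (if c < y then x < y else True) else (if c < y then False else x < y) := by
  have hc := c.isLt
  have hx := x.isLt
  have hy := y.isLt
  rw [Fin.lt_def, val_rotate, val_rotate]
  simp only [Fin.lt_def]
  split_ifs <;> simp <;> omega

end Rotation

/-! ### The product formula for `minimaj`. -/

section Miniwords

variable {m : ℕ}

/-- The arrangement of the block `S` in a miniword when the next letter is `c`. -/
def arrange (c : Fin (m + 1)) (S : Finset (Fin (m + 1))) : List (Fin (m + 1)) :=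
  (S.filter fun x => c < x).sort (· ≤ ·) ++ (S.filter fun x => x ≤ c).sort (· ≤ ·)

/-- The arrangement of a list of blocks in a miniword when the letter following it is `c`. -/
def miniwordBefore (c : Fin (m + 1)) : List (Finset (Fin (m + 1))) → List (Fin (m + 1))
  | [] => []
  | S :: L => arrange ((miniwordBefore c L).headD c) S ++ miniwordBefore c L

theorem miniwordList_append (L : List (Finset (Fin (m + 1)))) {c : Fin (m + 1)}
    {T : Finset (Fin (m + 1))} (hT : T ⊆ Ioi c) :
    miniwordList (L ++ [insert c T]) = miniwordBefore c L ++ c :: T.sort (· ≤ ·) := by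
  induction L with
  | nil =>
    simp only [List.nil_append, miniwordList, List.head?_nil, miniwordBefore]
    exact sort_insert _ (fun b hb => (mem_Ioi.1 (hT hb)).le)
      fun h => lt_irrefl c (mem_Ioi.1 (hT h))
  | cons S L ih =>
    rw [List.cons_append, miniwordList, ih]
    cases h : miniwordBefore c L with
    | nil => simp [miniwordBefore, h, arrange]
    | cons d w => simp [miniwordBefore, h, arrange]

theorem mem_arrange {c a : Fin (m + 1)} {S : Finset (Fin (m + 1))} : a ∈ arrange c S ↔ a ∈ S := by
  simp only [arrange, List.mem_append, mem_sort, mem_filter]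
  rcases lt_or_ge c a with h | h
  · simp [h]
  · simp [h]

/-- The arrangement before `c` is the increasing order for the alphabet `c+1, …, m, 0, …, c`. -/
theorem map_rotate_arrange (c : Fin (m + 1)) (S : Finset (Fin (m + 1))) :
    (arrange c S).map (rotate c) = (S.image (rotate c)).sort (· ≤ ·) := by
  have hp : ((arrange c S).map (rotate c)).Pairwise (· < ·) := by
    rw [List.pairwise_map, arrange, List.pairwise_append]
    simp only [rotate_lt_rotate, mem_sort, mem_filter]
    refine ⟨?_, ?_, ?_⟩
    · refine List.Pairwise.imp_of_mem ?_ (sortedLT_sort _).pairwise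
      intro a b ha hb hab
      simp only [mem_sort, mem_filter] at ha hb
      simp [ha.2, hb.2, hab]
    · refine List.Pairwise.imp_of_mem ?_ (sortedLT_sort _).pairwise
      intro a b ha hb hab
      simp only [mem_sort, mem_filter] at ha hb
      simp [ha.2.not_gt, hb.2.not_gt, hab]
    · intro a ha b hb
      simp [ha.2, hb.2.not_gt]
  have hS : S.image (rotate c) = ((arrange c S).map (rotate c)).toFinset := by
    ext a
    simp [mem_arrange]
  rw [hS]
  exact ((List.toFinset_sort _ (hp.imp ne_of_lt)).2 (hp.imp le_of_lt)).symm

theorem map_rotate_arrange' (c d : Fin (m + 1)) (S : Finset (Fin (m + 1))) :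
    (arrange d S).map (rotate c) = arrange (rotate c d) (S.image (rotate c)) := by
  refine List.map_injective_iff.2 (rotate (rotate c d)).injective ?_
  rw [map_rotate_arrange, List.map_map, image_image]
  have : (rotate (rotate c d)) ∘ (rotate c) = rotate d := funext fun x => rotate_rotate c d x
  rw [this, map_rotate_arrange]

/-- Arrangements depend only on the cyclic order of the letters. After rotation the following letter
`c` is the largest, so the block next to it is sorted increasingly, just like the final block of a
miniword. -/
theorem map_rotate_miniwordBefore (c : Fin (m + 1)) (L : List (Finset (Fin (m + 1)))) :
    (miniwordBefore c L).map (rotate c) = miniwordList (L.map (image (rotate c))) := by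
  induction L with
  | nil => rfl
  | cons S L ih =>
    rw [List.map_cons, miniwordList, ← ih]
    cases h : miniwordBefore c L with
    | nil => simp [miniwordBefore, h, map_rotate_arrange]
    | cons d w =>
      simp only [miniwordBefore, h, List.headD_cons, List.map_append, map_rotate_arrange',
        List.map_cons, List.head?_cons]
      rfl

/-- At each adjacent pair `e, d` the descent indicators before and after rotation differ by `[c < e]
- [c < d]`. Weighted by positions, these differences telescope to the number of letters above `c`;
the boundary term cancels the possible descent into the final `c`. -/
theorem wordMaj_rotate (c : Fin (m + 1)) (w : List (Fin (m + 1))) :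
    wordMaj (w ++ [c]) = wordMaj (w.map (rotate c)) + w.countP (c < ·) := by
  rcases List.eq_nil_or_concat w with rfl | ⟨u, d, rfl⟩
  · simp [wordMaj]
  rw [List.concat_eq_append, wordMaj_append_pair]
  induction u using List.reverseRecOn generalizing d with
  | nil =>
    by_cases h : c < d <;> simp [wordMaj, h]
  | append_singleton u e ih =>
    specialize ih e
    rw [wordMaj_append_pair, List.map_append, List.map_append, List.map_singleton,
      List.map_singleton, wordMaj_append_pair, List.countP_append]
    rw [List.map_append, List.map_singleton] at ih
    have h : (if d < e then 1 else 0) + (if c < d then 1 else 0) =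
        (if rotate c d < rotate c e then 1 else 0) + (if c < e then 1 else 0) := by
      simp only [rotate_lt_rotate]
      rcases lt_or_ge c d with hd | hd <;> rcases lt_or_ge c e with he | he
      · simp [hd, he]
      · simp [hd, he.not_gt, he.trans_lt hd |>.not_gt]
      · simp [hd.not_gt, he, hd.trans_lt he]
      · simp [hd.not_gt, he.not_gt]
    simp only [List.length_append, List.length_map, List.length_singleton, List.countP_singleton,
      decide_eq_true_eq]
    split_ifs at h ih ⊢ <;> omega

theorem countP_miniwordBefore (c : Fin (m + 1)) (L : List (Finset (Fin (m + 1)))) :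
    (miniwordBefore c L).countP (c < ·) = (L.map fun S => (S.filter (c < ·)).card).sum := by
  induction L with
  | nil => rfl
  | cons S L ih =>
    rw [miniwordBefore, List.countP_append, ih, List.map_cons, List.sum_cons]
    congr 1
    generalize (miniwordBefore c L).headD c = d
    have hn : (arrange d S).Nodup := by
      have := sort_nodup (S.image (rotate d)) (· ≤ ·)
      rw [← map_rotate_arrange] at this
      exact this.of_map
    rw [List.countP_eq_length_filter, ← List.toFinset_card_of_nodup (hn.filter _)]
    congr 1
    ext a
    simp [mem_arrange]

theorem hasLastMinFormula_minimaj {R : Type*} [CommRing R] (q : R) :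
    HasLastMinFormula (α := Fin (m + 1)) q fun _ => minimaj := by
  refine hasLastMinFormula_of_relabelling q ?_ rotate ?_
  · intro B
    simp [minimaj, miniword, miniwordList, wordMaj]
  · intro k B c T hT _
    have hB : List.ofFn (appendBlock B (insert c T)) = List.ofFn B ++ [insert c T] := by
      rw [List.ofFn_succ', List.concat_eq_append]
      simp
    have hp : (c :: T.sort (· ≤ ·)).Pairwise (· ≤ ·) := by
      simp only [List.pairwise_cons, mem_sort, pairwise_sort, and_true]
      exact fun a ha => (mem_Ioi.1 (hT ha)).le
    rw [minimaj, miniword, hB, miniwordList_append _ hT, wordMaj_append_of_pairwise _ _ _ hp,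
      wordMaj_rotate, map_rotate_miniwordBefore, countP_miniwordBefore, List.map_ofFn, List.map_ofFn,
      List.sum_ofFn]
    rfl

end Miniwords

/-! ### The product formula for `maj`. -/

section MajorIndex

variable {m : ℕ}

/-- The sum of the letters of `u` that follow the descents of `w`. -/
def pairMaj {α : Type*} [LinearOrder α] (w : List α) (u : List ℕ) : ℕ :=
  ∑ i ∈ descents w, u.getD (i + 1) 0

theorem pairMaj_append_pair {α : Type*} [LinearOrder α] (w : List α) (d c : α) (u : List ℕ)
    (t : ℕ) (h : u.length = w.length + 1) :
    pairMaj (w ++ [d] ++ [c]) (u ++ [t]) = pairMaj (w ++ [d]) u + if c < d then t else 0 := by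
  rw [pairMaj, sum_descents_append_pair, pairMaj]
  congr 1
  · refine sum_congr rfl fun i hi => ?_
    have := add_one_lt_length_of_mem_descents hi
    rw [List.getD_append]
    simpa [h] using this
  · simp [← h]

theorem sort_insert_ge {c : Fin (m + 1)} {T : Finset (Fin (m + 1))} (hT : T ⊆ Ioi c) :
    (insert c T).sort (· ≥ ·) = T.sort (· ≥ ·) ++ [c] := by
  have hp : (T.sort (· ≥ ·) ++ [c]).Pairwise (· > ·) := by
    rw [List.pairwise_append]
    refine ⟨(sortedGT_sort T).pairwise, List.pairwise_singleton _ _, ?_⟩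
    simp only [mem_sort, List.mem_singleton]
    rintro a ha b rfl
    exact mem_Ioi.1 (hT ha)
  have hS : insert c T = (T.sort (· ≥ ·) ++ [c]).toFinset := by
    ext a
    simp
  rw [hS]
  exact (List.toFinset_sort _ (hp.imp ne_of_gt)).2 (hp.imp le_of_lt)

theorem sigmaWord_appendBlock {k : ℕ} (B : Fin k → Finset (Fin (m + 1)))
    (S : Finset (Fin (m + 1))) :
    sigmaWord (appendBlock B S) = sigmaWord B ++ S.sort (· ≥ ·) := by
  rw [sigmaWord, List.ofFn_succ', List.concat_eq_append]
  simp [sigmaWord]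

theorem indexWord_appendBlock {k : ℕ} (B : Fin k → Finset (Fin (m + 1)))
    (S : Finset (Fin (m + 1))) :
    indexWord (appendBlock B S) = indexWord B ++ List.replicate S.card k := by
  rw [indexWord, List.ofFn_succ', List.concat_eq_append]
  simp [indexWord]

theorem length_indexWord {k : ℕ} (B : Fin k → Finset (Fin (m + 1))) :
    (indexWord B).length = (sigmaWord B).length := by
  simp [indexWord, sigmaWord, List.map_ofFn, Function.comp_def]

theorem maj_appendBlock_insert_insert {k : ℕ} (B : Fin k → Finset (Fin (m + 1)))
    {c d : Fin (m + 1)} {T : Finset (Fin (m + 1))} (hcd : c < d) (hT : T ⊆ Ioi d) :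
    maj (appendBlock B (insert c (insert d T))) = k + maj (appendBlock B (insert d T)) := by
  have hd : insert d T ⊆ Ioi c := by
    intro a ha
    rcases mem_insert.1 ha with rfl | ha
    · exact mem_Ioi.2 hcd
    · exact mem_Ioi.2 (hcd.trans (mem_Ioi.1 (hT ha)))
  have hc : c ∉ insert d T := fun h => lt_irrefl c (mem_Ioi.1 (hd h))
  have := pairMaj_append_pair (sigmaWord B ++ T.sort (· ≥ ·)) d c
    (indexWord (appendBlock B (insert d T))) k
    (by simp [length_indexWord, sigmaWord_appendBlock, sort_insert_ge hT, add_assoc])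
  change pairMaj _ _ = _ + pairMaj _ _
  rw [sigmaWord_appendBlock, sort_insert_ge hd, sort_insert_ge hT, indexWord_appendBlock,
    card_insert_of_notMem hc, List.replicate_succ', ← List.append_assoc, ← List.append_assoc,
    ← List.append_assoc, ← indexWord_appendBlock, this, if_pos hcd, add_comm,
    sigmaWord_appendBlock, sort_insert_ge hT, ← List.append_assoc]

theorem maj_appendBlock_singleton {k : ℕ} (B : Fin k → Finset (Fin (m + 1)))
    {c d : Fin (m + 1)} {T : Finset (Fin (m + 1))} (hT : T ⊆ Ioi d) :
    maj (appendBlock (appendBlock B (insert d T)) {c}) =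
      maj (appendBlock B (insert d T)) + if c < d then k + 1 else 0 := by
  have := pairMaj_append_pair (sigmaWord B ++ T.sort (· ≥ ·)) d c
    (indexWord (appendBlock B (insert d T))) (k + 1)
    (by simp [length_indexWord, sigmaWord_appendBlock, sort_insert_ge hT, add_assoc])
  change pairMaj _ _ = pairMaj _ _ + _
  rw [sigmaWord_appendBlock, sigmaWord_appendBlock, indexWord_appendBlock (S := {c}),
    sort_insert_ge hT, ← List.append_assoc]
  simpa using this

variable {R : Type*} [CommRing R]

/-- Either the last block is `{c}`, or removing `c` leaves a block with minimum `d > c`; then the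
descent from `d` to `c` inside the block of index `k` costs `q ^ k`. -/
theorem lastMinGF_maj (q : R) (x : Fin (m + 1) → R) (k : ℕ) (c : Fin (m + 1)) :
    lastMinGF q x (fun _ => maj) k c = x c *
      (∑ B ∈ nonemptyTuples (Fin (m + 1)) k, q ^ maj (appendBlock B {c}) * weight x B +
        q ^ k * ∑ d ∈ Ioi c, lastMinGF q x (fun _ => maj) k d) := by
  have hsplit : ∀ φ : Finset (Fin (m + 1)) → R, ∑ T ∈ (Ioi c).powerset, φ T =
      φ ∅ + ∑ d ∈ Ioi c, ∑ T ∈ (Ioi d).powerset, φ (insert d T) := fun φ => by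
    rw [← sum_powerset_erase_empty (Ioi c) fun d hd a hda =>
      mem_Ioi.2 ((mem_Ioi.1 hd).trans hda), add_sum_erase _ _ (empty_mem_powerset _)]
  simp only [lastMinGF]
  simp only [hsplit]
  rw [sum_add_distrib, mul_add, mul_sum]
  congr 1
  · refine sum_congr rfl fun B _ => ?_
    rw [weight_appendBlock]
    simp
    ring
  · rw [sum_comm, mul_sum, mul_sum]
    refine sum_congr rfl fun d hd => ?_
    rw [mul_sum, mul_sum]
    refine sum_congr rfl fun B _ => ?_
    rw [mul_sum, mul_sum]
    refine sum_congr rfl fun T hT => ?_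
    have hcd := mem_Ioi.1 hd
    have hT := mem_powerset.1 hT
    have hc : c ∉ insert d T := by
      simp only [mem_insert, not_or]
      exact ⟨hcd.ne, fun h => lt_asymm hcd (mem_Ioi.1 (hT h))⟩
    rw [maj_appendBlock_insert_insert B hcd hT, weight_appendBlock, weight_appendBlock,
      prod_insert hc]
    ring

/-- The preceding block ends in its minimum `d`, so appending `{c}` costs `q ^ (k + 1)` exactly when
`d > c`. -/
theorem sum_maj_appendBlock_singleton_succ (q : R) (x : Fin (m + 1) → R) (k : ℕ)
    (c : Fin (m + 1)) :
    ∑ B ∈ nonemptyTuples (Fin (m + 1)) (k + 1), q ^ maj (appendBlock B {c}) * weight x B =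
      tupleGF q x (fun _ => maj) (k + 1) - ∑ d ∈ Ioi c, lastMinGF q x (fun _ => maj) k d +
        q ^ (k + 1) * ∑ d ∈ Ioi c, lastMinGF q x (fun _ => maj) k d := by
  have h : ∑ B ∈ nonemptyTuples (Fin (m + 1)) (k + 1), q ^ maj (appendBlock B {c}) * weight x B =
      ∑ d, (if c < d then q ^ (k + 1) else 1) * lastMinGF q x (fun _ => maj) k d := by
    rw [nonemptyTuples, sum_piFinset_appendBlock, ← powerset_univ,
      sum_powerset_erase_empty univ (by simp)]
    refine sum_congr rfl fun d _ => ?_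
    rw [lastMinGF, sum_comm, mul_sum]
    refine sum_congr rfl fun B _ => ?_
    rw [mul_sum]
    refine sum_congr rfl fun T hT => ?_
    rw [maj_appendBlock_singleton B (mem_powerset.1 hT)]
    split_ifs <;> ring
  have hI : ∑ d ∈ Ioi c, lastMinGF q x (fun _ => maj) k d =
      ∑ d, if c < d then lastMinGF q x (fun _ => maj) k d else 0 := by
    rw [← sum_filter]
    exact sum_congr (by ext; simp) fun _ _ => rfl
  rw [h, tupleGF_succ, hI, mul_sum, ← sum_sub_distrib, ← sum_add_distrib]
  exact sum_congr rfl fun d _ => by split_ifs <;> ring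

theorem hasLastMinFormula_maj (q : R) :
    HasLastMinFormula (α := Fin (m + 1)) q fun _ => maj := by
  have h0 : ∀ B : Fin 0 → Finset (Fin (m + 1)), maj B = 0 := fun B => by
    simp [maj, sigmaWord]
  refine hasLastMinFormula_of_step h0 fun N H x c => ?_
  have hrec : ∀ c, qEsymmSum q N (fun k => lastMinGF q x (fun _ => maj) k c) = x c *
      (boxProd q N x +
        q ^ N * ∑ d ∈ Ioi c, qEsymmSum q N (fun k => lastMinGF q x (fun _ => maj) k d)) := by
    intro c
    -- `g k` counts sequences of `k` blocks whose last minimum exceeds `c`; the value `0` at `k = 0`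
    -- makes the recursion uniform in `k`.
    let g : ℕ → R := fun k => k.casesOn 0 fun k => ∑ d ∈ Ioi c, lastMinGF q x (fun _ => maj) k d
    have hk : ∀ k, lastMinGF q x (fun _ => maj) k c = x c *
        ((tupleGF q x (fun _ => maj) k - g k) + (q ^ k * g k + q ^ k * g (k + 1))) := by
      intro k
      rw [lastMinGF_maj]
      congr 1
      cases k with
      | zero =>
        have hc : ∀ B : Fin 0 → Finset (Fin (m + 1)), maj (appendBlock B {c}) = 0 := fun B => by
          rw [maj, sigmaWord_appendBlock]
          simp [sigmaWord]
        simp [g, nonemptyTuples, tupleGF_zero q x h0, weight, hc]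
      | succ k =>
        rw [sum_maj_appendBlock_singleton_succ]
        simp only [g]
        ring
    simp only [hk]
    -- The two terms with `q ^ k` combine to the pairing of `g` at `N + 1`. Expanding it by the
    -- other recursion produces the pairing of `g` at `N`, which cancels the subtracted one.
    rw [qEsymmSum_mul_left, qEsymmSum_add, qEsymmSum_add, ← qEsymmSum_succ', qEsymmSum_succ,
      qEsymmSum_sub, H, ← qEsymmSum_sum]
    simp only [g]
    ring
  induction c using WellFoundedGT.induction with
  | ind c ih =>
    rw [hrec, sum_congr rfl fun d hd => ih d (mem_Ioi.1 hd)]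
    have := sum_mul_prod_Ioi (Ioi c) (fun d hd a hda => mem_Ioi.2 ((mem_Ioi.1 hd).trans hda))
      fun a => q ^ N * x a
    rw [eq_sub_iff_add_eq'] at this
    rw [← this, mul_left_comm (boxProd q N x), mul_add (boxProd q N x), mul_one, mul_sum, mul_sum]
    congr 2
    exact sum_congr rfl fun d _ => by ring

end MajorIndex

/-! ### Ranks of elements in a finite set. -/

section Ranks

variable {α : Type*} [LinearOrder α]

/-- The number of elements of `S` smaller than `x`. -/
def rankIn (S : Finset α) (x : α) : ℕ :=
  (S.filter (· < x)).card

theorem rankIn_lt_card {S : Finset α} {x : α} (hx : x ∈ S) : rankIn S x < S.card :=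
  card_lt_card (filter_ssubset.2 ⟨x, hx, lt_irrefl x⟩)

theorem rankIn_lt_rankIn {S : Finset α} {x y : α} (hx : x ∈ S) (h : x < y) :
    rankIn S x < rankIn S y := by
  refine card_lt_card (ssubset_iff_of_subset ?_ |>.2 ⟨x, by simp [hx, h], by simp⟩)
  exact monotone_filter_right _ fun a _ ha => lt_trans ha h

theorem rankIn_injOn (S : Finset α) : Set.InjOn (rankIn S) S := by
  intro x hx y hy h
  by_contra hne
  rcases lt_or_gt_of_ne hne with hlt | hlt
  · exact (rankIn_lt_rankIn hx hlt).ne h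
  · exact (rankIn_lt_rankIn hy hlt).ne' h

theorem image_rankIn (S : Finset α) : S.image (rankIn S) = range S.card := by
  refine eq_of_subset_of_card_le ?_ ?_
  · intro i hi
    obtain ⟨x, hx, rfl⟩ := mem_image.1 hi
    exact mem_range.2 (rankIn_lt_card hx)
  · rw [card_range, card_image_of_injOn (rankIn_injOn S)]

theorem sum_rankIn {M : Type*} [AddCommMonoid M] (S : Finset α) (f : ℕ → M) :
    ∑ x ∈ S, f (rankIn S x) = ∑ i ∈ range S.card, f i := by
  rw [← image_rankIn, sum_image (rankIn_injOn S)]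

theorem prod_rankIn {M : Type*} [CommMonoid M] (S : Finset α) (f : ℕ → M) :
    ∏ x ∈ S, f (rankIn S x) = ∏ i ∈ range S.card, f i := by
  rw [← image_rankIn, prod_image (rankIn_injOn S)]

theorem rankIn_insert_of_lt {S : Finset α} {n x : α} (h : x < n) :
    rankIn (insert n S) x = rankIn S x := by
  rw [rankIn, filter_insert, if_neg h.not_gt, rankIn]

theorem rankIn_insert_self {S : Finset α} {n : α} (h : ∀ a ∈ S, a < n) :
    rankIn (insert n S) n = S.card := by
  rw [rankIn, filter_insert, if_neg (lt_irrefl n), filter_true_of_mem h]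

end Ranks

/-! ### Diagonal inversions between two blocks. -/

section DiagonalInversions

variable {m : ℕ}

/-- The number of diagonal inversions between the block `A` and a later block `S`. -/
def pairDinv (A S : Finset (Fin (m + 1))) : ℕ :=
  ∑ x ∈ A, ∑ y ∈ S, ((if rankIn A x = rankIn S y ∧ y < x then 1 else 0) +
    (if rankIn A x + 1 = rankIn S y ∧ x < y then 1 else 0))

/-- An element is determined by its rank, so heights correspond to pairs of entries. The shift `s`
is `0` for primary and `1` for secondary inversions. -/
theorem card_filter_isNthSmallest (A S : Finset (Fin (m + 1))) (s : ℕ)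
    (r : Fin (m + 1) → Fin (m + 1) → Prop) [DecidableRel r] :
    ((Icc 1 (m + 1)).filter fun h =>
      ∃ x y, IsNthSmallest A h x ∧ IsNthSmallest S (h + s) y ∧ r x y).card =
      ∑ x ∈ A, ∑ y ∈ S, if rankIn A x + s = rankIn S y ∧ r x y then 1 else 0 := by
  rw [← sum_product', ← card_filter]
  symm
  refine card_bij (fun p _ => rankIn A p.1 + 1) ?_ ?_ ?_
  · rintro ⟨x, y⟩ h
    simp only [mem_filter, mem_product] at h
    obtain ⟨⟨hx, hy⟩, he, hr⟩ := h
    have h₁ := rankIn_lt_card hx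
    have h₂ : A.card ≤ m + 1 := by simpa using card_le_univ A
    simp only [mem_filter, mem_Icc]
    exact ⟨⟨by omega, by omega⟩, x, y, ⟨hx, rfl⟩, ⟨hy, by
      change rankIn S y + 1 = _
      omega⟩, hr⟩
  · rintro ⟨x, y⟩ h ⟨x', y'⟩ h' he
    simp only [mem_filter, mem_product] at h h'
    have hx := rankIn_injOn A h.1.1 h'.1.1 (by simpa using he)
    subst hx
    have hy := rankIn_injOn S h.1.2 h'.1.2 (h.2.1.symm.trans h'.2.1)
    rw [hy]
  · intro h hh
    simp only [mem_filter, mem_Icc] at hh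
    obtain ⟨_, x, y, ⟨hx, hx'⟩, ⟨hy, hy'⟩, hr⟩ := hh
    change rankIn A x + 1 = h at hx'
    change rankIn S y + 1 = h + s at hy'
    exact ⟨(x, y), by simp only [mem_filter, mem_product]; exact ⟨⟨hx, hy⟩, by omega, hr⟩, hx'⟩

theorem dinv_eq_sum {k : ℕ} (B : Fin k → Finset (Fin (m + 1))) :
    dinv B = ∑ i, ∑ j, if i < j then pairDinv (B i) (B j) else 0 := by
  have h₁ : (primaryDinvs B).card = ∑ i, ∑ j, if i < j then
      ∑ x ∈ B i, ∑ y ∈ B j, (if rankIn (B i) x + 0 = rankIn (B j) y ∧ y < x then 1 else 0)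
      else 0 := by
    rw [primaryDinvs, card_filter, sum_product, sum_comm, Fintype.sum_prod_type]
    refine sum_congr rfl fun i _ => sum_congr rfl fun j _ => ?_
    split_ifs with h
    · rw [← card_filter_isNthSmallest, card_filter]
      simp [h]
    · simp [h]
  have h₂ : (secondaryDinvs B).card = ∑ i, ∑ j, if i < j then
      ∑ x ∈ B i, ∑ y ∈ B j, (if rankIn (B i) x + 1 = rankIn (B j) y ∧ x < y then 1 else 0)
      else 0 := by
    rw [secondaryDinvs, card_filter, sum_product, sum_comm, Fintype.sum_prod_type]
    refine sum_congr rfl fun i _ => sum_congr rfl fun j _ => ?_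
    split_ifs with h
    · rw [← card_filter_isNthSmallest, card_filter]
      simp [h]
    · simp [h]
  rw [dinv, h₁, h₂, ← sum_add_distrib]
  refine sum_congr rfl fun i _ => ?_
  rw [← sum_add_distrib]
  refine sum_congr rfl fun j _ => ?_
  split_ifs
  · simp only [pairDinv, sum_add_distrib, add_zero]
  · rfl

/-- As the largest letter, `n` lands on top. In `A`, at height `|A| + 1`, it beats the entry of `S`
at that height, if any. In `S`, at height `|S| + 1`, it exceeds the entry of `A` at height `|S|`, if
any. Two copies of `n` never compare strictly. -/
theorem pairDinv_insert {n : Fin (m + 1)} {A S : Finset (Fin (m + 1))} (hA : ∀ a ∈ A, a < n)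
    (hS : ∀ a ∈ S, a < n) (P Q : Prop) [Decidable P] [Decidable Q] :
    pairDinv (if P then insert n A else A) (if Q then insert n S else S) =
      pairDinv A S + (if P ∧ A.card < S.card then 1 else 0) +
        (if Q ∧ 0 < S.card ∧ S.card ≤ A.card then 1 else 0) := by
  have hnA : n ∉ A := fun h => lt_irrefl n (hA n h)
  have hnS : n ∉ S := fun h => lt_irrefl n (hS n h)
  have hinsA : ∀ x ∈ A, rankIn (insert n A) x = rankIn A x := fun x hx =>
    rankIn_insert_of_lt (hA x hx)
  have hinsS : ∀ x ∈ S, rankIn (insert n S) x = rankIn S x := fun x hx =>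
    rankIn_insert_of_lt (hS x hx)
  have hrow : ∑ y ∈ S, ((if A.card = rankIn S y ∧ y < n then 1 else 0) +
      (if A.card + 1 = rankIn S y ∧ n < y then 1 else 0)) =
      if A.card < S.card then 1 else 0 := by
    rw [sum_congr rfl (g := fun y => if A.card = rankIn S y then 1 else 0) fun y hy => by
      simp [hS y hy, (hS y hy).not_gt], sum_rankIn S fun i => if A.card = i then 1 else 0]
    simp
  have hcol : ∑ x ∈ A, ((if rankIn A x = S.card ∧ n < x then 1 else 0) +
      (if rankIn A x + 1 = S.card ∧ x < n then 1 else 0)) =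
      if 0 < S.card ∧ S.card ≤ A.card then 1 else 0 := by
    rw [sum_congr rfl (g := fun x => if rankIn A x + 1 = S.card then 1 else 0) fun x hx => by
      simp [hA x hx, (hA x hx).not_gt], sum_rankIn A fun i => if i + 1 = S.card then 1 else 0]
    rcases Nat.eq_zero_or_pos S.card with h | h
    · simp [h]
    · rw [sum_congr rfl (g := fun i => if i = S.card - 1 then 1 else 0) fun i _ => by
        congr 1; exact propext (by omega)]
      rw [sum_ite_eq']
      congr 1
      simp only [mem_range]
      exact propext (by omega)
  have h₁ : pairDinv (insert n A) S = pairDinv A S + if A.card < S.card then 1 else 0 := by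
    rw [pairDinv, sum_insert hnA, rankIn_insert_self hA, hrow, add_comm]
    congr 1
    exact sum_congr rfl fun x hx => by rw [hinsA x hx]
  have h₂ : ∀ x ∈ A, ∑ y ∈ insert n S, ((if rankIn A x = rankIn (insert n S) y ∧ y < x then 1 else 0)
      + (if rankIn A x + 1 = rankIn (insert n S) y ∧ x < y then 1 else 0)) =
      ((if rankIn A x = S.card ∧ n < x then 1 else 0) +
      (if rankIn A x + 1 = S.card ∧ x < n then 1 else 0)) +
      ∑ y ∈ S, ((if rankIn A x = rankIn S y ∧ y < x then 1 else 0) +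
      (if rankIn A x + 1 = rankIn S y ∧ x < y then 1 else 0)) := by
    intro x _
    rw [sum_insert hnS, rankIn_insert_self hS]
    congr 1
    exact sum_congr rfl fun y hy => by rw [hinsS y hy]
  have h₃ : pairDinv A (insert n S) =
      pairDinv A S + if 0 < S.card ∧ S.card ≤ A.card then 1 else 0 := by
    rw [pairDinv, sum_congr rfl h₂, sum_add_distrib, hcol, add_comm]
    rfl
  have h₄ : pairDinv (insert n A) (insert n S) = pairDinv A (insert n S) +
      if A.card < S.card then 1 else 0 := by
    rw [pairDinv, sum_insert hnA, rankIn_insert_self hA, sum_insert hnS, rankIn_insert_self hS,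
      sum_congr rfl (s₁ := S) fun y hy => by rw [hinsS y hy], hrow, add_comm]
    congr 1
    · exact sum_congr rfl fun x hx => by rw [hinsA x hx]
    · simp
  split_ifs with hP hQ <;> simp_all

end DiagonalInversions

/-! ### Inserting a new largest letter into possibly empty blocks. -/

section Insertion

variable {m N : ℕ}

/-- The sequence obtained from `B` by inserting the letter `n` into the blocks indexed by `J`. -/
def insertLetter (n : Fin (m + 1)) (B : Fin N → Finset (Fin (m + 1))) (J : Finset (Fin N)) :
    Fin N → Finset (Fin (m + 1)) :=
  fun i => if i ∈ J then insert n (B i) else B i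

theorem sum_insertLetter {M : Type*} [AddCommMonoid M] {n : Fin (m + 1)}
    {U : Finset (Fin (m + 1))} (hn : n ∉ U) (φ : (Fin N → Finset (Fin (m + 1))) → M) :
    ∑ B ∈ Fintype.piFinset (fun _ : Fin N => (insert n U).powerset), φ B =
      ∑ B ∈ Fintype.piFinset (fun _ : Fin N => U.powerset), ∑ J ∈ (univ : Finset (Fin N)).powerset,
        φ (insertLetter n B J) := by
  rw [← sum_product']
  symm
  have hnot : ∀ {B : Fin N → Finset (Fin (m + 1))},
      B ∈ Fintype.piFinset (fun _ : Fin N => U.powerset) → ∀ i, n ∉ B i := fun hB i h =>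
    hn (mem_powerset.1 (Fintype.mem_piFinset.1 hB i) h)
  refine sum_nbij' (fun p => insertLetter n p.1 p.2)
    (fun B => (fun i => (B i).erase n, univ.filter fun i => n ∈ B i)) ?_ ?_ ?_ ?_ ?_
  · rintro ⟨B, J⟩ h
    have hB := Fintype.mem_piFinset.1 (mem_product.1 h).1
    refine Fintype.mem_piFinset.2 fun i => ?_
    have := mem_powerset.1 (hB i)
    simp only [insertLetter, mem_powerset]
    split_ifs
    · exact insert_subset_insert n this
    · exact this.trans (subset_insert n U)
  · intro B hB
    refine mem_product.2 ⟨Fintype.mem_piFinset.2 fun i => ?_, by simp⟩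
    exact mem_powerset.2 (subset_insert_iff.1 (mem_powerset.1 (Fintype.mem_piFinset.1 hB i)))
  · rintro ⟨B, J⟩ h
    have hB := hnot (mem_product.1 h).1
    refine Prod.ext (funext fun i => ?_) ?_
    · simp only [insertLetter]
      split_ifs
      · exact erase_insert (hB i)
      · exact erase_eq_of_notMem (hB i)
    · ext i
      by_cases hi : i ∈ J <;> simp [insertLetter, hi, hB i]
  · intro B _
    funext i
    by_cases hi : n ∈ B i <;> simp [insertLetter, hi, insert_erase]
  · intros
    rfl

/-- The sum of the indices of the non-empty blocks. -/
def nonemptyIndexSum {α : Type*} (B : Fin N → Finset α) : ℕ :=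
  ∑ i, if (B i).Nonempty then (i : ℕ) else 0

theorem sum_ite_lt_eq_val (j : Fin N) : ∑ i : Fin N, (if i < j then 1 else 0) = (j : ℕ) := by
  rw [← card_filter, ← Fin.card_Iio]
  congr 1
  ext i
  simp

/-- The blocks ordered by decreasing size and then from left to right. -/
def sizeKey {α : Type*} (B : Fin N → Finset α) (i : Fin N) : ℕᵒᵈ ×ₗ Fin N :=
  toLex (OrderDual.toDual (B i).card, i)

theorem sizeKey_injective {α : Type*} (B : Fin N → Finset α) : Function.Injective (sizeKey B) :=
  fun _ _ h => (Prod.ext_iff.1 (toLex.injective h)).2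

theorem sizeKey_lt {α : Type*} (B : Fin N → Finset α) (i j : Fin N) :
    sizeKey B i < sizeKey B j ↔ (B j).card < (B i).card ∨ (B i).card = (B j).card ∧ i < j := by
  rw [sizeKey, sizeKey, Prod.Lex.toLex_lt_toLex]
  exact Iff.rfl

/-- The number of blocks preceding the `j`-th one by decreasing size and then from left to
right. -/
def sizeRank {α : Type*} (B : Fin N → Finset α) (j : Fin N) : ℕ :=
  ∑ i, if (B j).card < (B i).card ∨ (B i).card = (B j).card ∧ i < j then 1 else 0

theorem prod_sizeRank {α M : Type*} [CommMonoid M] (B : Fin N → Finset α) (f : ℕ → M) :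
    ∏ j, f (sizeRank B j) = ∏ p ∈ range N, f p := by
  have h : ∀ j, sizeRank B j = rankIn (univ.image (sizeKey B)) (sizeKey B j) := by
    intro j
    rw [rankIn, filter_image, card_image_of_injective _ (sizeKey_injective B), card_filter]
    simp only [sizeKey_lt]
    rfl
  have hc : (univ.image (sizeKey B)).card = N := by
    rw [card_image_of_injective _ (sizeKey_injective B), card_univ, Fintype.card_fin]
  simp only [h]
  rw [← prod_image (f := fun t => f (rankIn (univ.image (sizeKey B)) t))
    (sizeKey_injective B).injOn, prod_rankIn, hc]

/-- Inserting `n` into block `j` creates one diagonal inversion for each larger block to the right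
and, if block `j` is non-empty, one for each block to the left at least as large. If block `j` is
empty, the second count is replaced by the growth `j` of the index sum. Either way the total is
`sizeRank B j`. -/
theorem dinv_insertLetter {n : Fin (m + 1)} {B : Fin N → Finset (Fin (m + 1))}
    (hB : ∀ i, ∀ a ∈ B i, a < n) (J : Finset (Fin N)) :
    dinv (insertLetter n B J) + nonemptyIndexSum (insertLetter n B J) =
      dinv B + nonemptyIndexSum B + ∑ j ∈ J, sizeRank B j := by
  have h₁ : dinv (insertLetter n B J) = dinv B +
      ∑ j ∈ J, ∑ i, (if j < i ∧ (B j).card < (B i).card then 1 else 0) +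
      ∑ j ∈ J, ∑ i, (if i < j ∧ 0 < (B j).card ∧ (B j).card ≤ (B i).card then 1 else 0) := by
    have hJ : ∀ f : Fin N → ℕ, ∑ j ∈ J, f j = ∑ j, if j ∈ J then f j else 0 := fun f => by
      rw [← sum_filter, filter_mem_eq_inter, univ_inter]
    rw [hJ, hJ, dinv_eq_sum, dinv_eq_sum]
    have : (∑ j, if j ∈ J then
        ∑ i, (if i < j ∧ 0 < (B j).card ∧ (B j).card ≤ (B i).card then 1 else 0) else 0) =
        ∑ i, ∑ j, (if j ∈ J then
          (if i < j ∧ 0 < (B j).card ∧ (B j).card ≤ (B i).card then 1 else 0) else 0) := by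
      rw [sum_comm]
      refine sum_congr rfl fun j _ => ?_
      split_ifs <;> simp
    rw [this, ← sum_add_distrib, ← sum_add_distrib]
    refine sum_congr rfl fun i _ => ?_
    have : (if i ∈ J then ∑ j, (if i < j ∧ (B i).card < (B j).card then 1 else 0) else 0) =
        ∑ j, if i ∈ J then (if i < j ∧ (B i).card < (B j).card then 1 else 0) else 0 := by
      split_ifs <;> simp
    rw [this, ← sum_add_distrib, ← sum_add_distrib]
    refine sum_congr rfl fun j _ => ?_
    by_cases hij : i < j
    · simp only [hij, if_true, true_and, insertLetter]
      rw [pairDinv_insert (hB i) (hB j), ite_and, ite_and (j ∈ J)]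
    · simp [hij]
  have h₂ : nonemptyIndexSum (insertLetter n B J) = nonemptyIndexSum B +
      ∑ j ∈ J, ∑ i, (if i < j ∧ (B j).card = 0 then 1 else 0) := by
    rw [nonemptyIndexSum, nonemptyIndexSum, ← sum_filter_add_sum_filter_not univ (· ∈ J),
      ← sum_filter_add_sum_filter_not (univ : Finset (Fin N)) (· ∈ J)
        fun i => if (B i).Nonempty then (i : ℕ) else 0, add_right_comm]
    congr 1
    · rw [filter_mem_eq_inter, univ_inter, ← sum_add_distrib]
      refine sum_congr rfl fun j hj => ?_
      simp only [insertLetter, hj, if_true, insert_nonempty]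
      rcases (B j).eq_empty_or_nonempty with h | h
      · simp [h, sum_ite_lt_eq_val, -sum_boole]
      · simp [h, h.ne_empty]
    · refine sum_congr rfl fun j hj => ?_
      simp [insertLetter, (mem_filter.1 hj).2]
  rw [h₁, h₂]
  have h₃ : ∑ j ∈ J, sizeRank B j =
      ∑ j ∈ J, ∑ i, (if j < i ∧ (B j).card < (B i).card then 1 else 0) +
      ∑ j ∈ J, ∑ i, (if i < j ∧ 0 < (B j).card ∧ (B j).card ≤ (B i).card then 1 else 0) +
      ∑ j ∈ J, ∑ i, (if i < j ∧ (B j).card = 0 then 1 else 0) := by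
    rw [← sum_add_distrib, ← sum_add_distrib]
    refine sum_congr rfl fun j _ => ?_
    rw [sizeRank, ← sum_add_distrib, ← sum_add_distrib]
    refine sum_congr rfl fun i _ => ?_
    rcases lt_trichotomy i j with h | rfl | h
    · simp only [h, h.not_gt, true_and, false_and, and_true, if_false]
      split_ifs <;> omega
    · simp
    · simp [h, h.not_gt]
  rw [h₃]
  ring

variable {R : Type*} [CommRing R]

theorem weight_insertLetter {n : Fin (m + 1)} {B : Fin N → Finset (Fin (m + 1))}
    (hB : ∀ i, n ∉ B i) (J : Finset (Fin N)) (x : Fin (m + 1) → R) :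
    weight x (insertLetter n B J) = weight x B * ∏ _j ∈ J, x n := by
  have hJ : ∏ _j ∈ J, x n = ∏ j, if j ∈ J then x n else 1 := by
    rw [← prod_filter, filter_mem_eq_inter, univ_inter]
  rw [hJ, weight, weight, ← prod_mul_distrib]
  refine prod_congr rfl fun i _ => ?_
  by_cases hi : i ∈ J
  · simp [insertLetter, hi, prod_insert (hB i), mul_comm]
  · simp [insertLetter, hi]

/-- The diagonal inversion generating function of the sequences of possibly empty blocks in which
the letter `0` is only allowed in the blocks indexed by `V`. -/
theorem sum_dinv_nonemptyIndexSum (q : R) (x : Fin (m + 1) → R) (V : Finset (Fin N))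
    [DecidablePred fun B : Fin N → Finset (Fin (m + 1)) => ∀ i, 0 ∈ B i → i ∈ V] :
    (∑ B ∈ Fintype.piFinset (fun _ : Fin N => (univ : Finset (Fin (m + 1))).powerset),
      if ∀ i, 0 ∈ B i → i ∈ V then q ^ (dinv B + nonemptyIndexSum B) * weight x B else 0) =
      (∏ j ∈ V, (1 + q ^ (j : ℕ) * x 0)) *
        ∏ a ∈ univ.erase 0, ∏ p ∈ range N, (1 + q ^ p * x a) := by
  suffices H : ∀ U : Finset (Fin (m + 1)), 0 ∉ U →
      (∑ B ∈ Fintype.piFinset (fun _ : Fin N => (insert 0 U).powerset),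
        if ∀ i, 0 ∈ B i → i ∈ V then q ^ (dinv B + nonemptyIndexSum B) * weight x B else 0) =
      (∏ j ∈ V, (1 + q ^ (j : ℕ) * x 0)) * ∏ a ∈ U, ∏ p ∈ range N, (1 + q ^ p * x a) by
    have := H (univ.erase 0) (by simp)
    rwa [insert_erase (mem_univ _)] at this
  intro U
  induction U using Finset.induction_on_max with
  | empty =>
    intro _
    -- All blocks are empty when `0` is inserted, so block `j` has size rank `j`; restricting the
    -- positions to `V` therefore still gives a product.
    rw [sum_insertLetter (notMem_empty _)]
    have hs : Fintype.piFinset (fun _ : Fin N => (∅ : Finset (Fin (m + 1))).powerset) =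
        {fun _ => ∅} := by
      ext B
      simp [funext_iff]
    rw [hs, sum_singleton, prod_empty, mul_one, prod_one_add]
    symm
    have hz : dinv (fun _ : Fin N => (∅ : Finset (Fin (m + 1)))) = 0 := by
      simp [dinv_eq_sum, pairDinv]
    refine (sum_congr rfl fun J hJ => ?_).trans
      (sum_subset (powerset_mono.2 (subset_univ V)) fun J _ hJ => ?_)
    · rw [if_pos, dinv_insertLetter (by simp), weight_insertLetter (by simp), hz, pow_add,
        prod_mul_distrib, prod_pow_eq_pow_sum]
      · simp [nonemptyIndexSum, weight, sizeRank, sum_ite_lt_eq_val, -sum_boole]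
      · intro i hi
        by_contra hV
        have : i ∉ J := fun h => hV (mem_powerset.1 hJ h)
        simp [insertLetter, this] at hi
    · rw [if_neg]
      intro h
      exact hJ (mem_powerset.2 fun i hi => h i (by simp [insertLetter, hi]))
  | insert n U hU ih =>
    intro h0
    simp only [mem_insert, not_or] at h0
    have hlt : ∀ a ∈ insert 0 U, a < n := by
      intro a ha
      rcases mem_insert.1 ha with rfl | ha
      · exact Fin.pos_iff_ne_zero.2 (Ne.symm h0.1)
      · exact hU a ha
    have hn : n ∉ insert 0 U := fun h => lt_irrefl n (hlt n h)
    rw [insert_comm, sum_insertLetter hn, prod_insert fun h => hn (mem_insert_of_mem h),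
      mul_left_comm, ← ih h0.2, mul_sum]
    refine sum_congr rfl fun B hB => ?_
    have hBn : ∀ i, ∀ a ∈ B i, a < n := fun i a ha =>
      hlt a (mem_powerset.1 (Fintype.mem_piFinset.1 hB i) ha)
    have h0B : ∀ J, (∀ i, 0 ∈ insertLetter n B J i → i ∈ V) ↔ ∀ i, 0 ∈ B i → i ∈ V := by
      intro J
      refine forall_congr' fun i => ?_
      simp only [insertLetter]
      split_ifs
      · rw [mem_insert, or_iff_right h0.1]
      · rfl
    simp only [h0B]
    split_ifs
    · rw [← prod_sizeRank B fun p => 1 + q ^ p * x n, prod_one_add, sum_mul]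
      refine sum_congr rfl fun J _ => ?_
      rw [dinv_insertLetter hBn, weight_insertLetter fun i h => lt_irrefl n (hBn i n h), pow_add,
        prod_mul_distrib, prod_pow_eq_pow_sum]
      ring
    · simp

end Insertion

/-! ### Discarding empty blocks. -/

section EmptyBlocks

variable {R : Type*} [CommRing R]

theorem ofFn_appendBlock {α : Type*} {k : ℕ} (B : Fin k → Finset α) (S : Finset α) :
    List.ofFn (appendBlock B S) = List.ofFn B ++ [S] := by
  rw [List.ofFn_succ', List.concat_eq_append]
  simp

theorem nonemptyIndexSum_appendBlock {α : Type*} {N : ℕ} (B : Fin N → Finset α) (S : Finset α) :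
    nonemptyIndexSum (appendBlock B S) = nonemptyIndexSum B + if S.Nonempty then N else 0 := by
  simp [nonemptyIndexSum, Fin.sum_univ_castSucc]

/-- Summing over the positions of the empty blocks. -/
theorem sum_nonemptyIndexSum {α : Type*} [Fintype α] [DecidableEq α] (q : R) (N : ℕ)
    (φ : List (Finset α) → R) :
    ∑ B ∈ Fintype.piFinset (fun _ : Fin N => (univ : Finset α).powerset),
      q ^ nonemptyIndexSum B * φ ((List.ofFn B).filter (·.Nonempty)) =
      qEsymmSum q N fun k => ∑ B ∈ nonemptyTuples α k, φ (List.ofFn B) := by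
  induction N generalizing φ with
  | zero => simp [nonemptyIndexSum, nonemptyTuples]
  | succ N ih =>
    -- Whether the last block is empty or not corresponds to the two terms of the recursion; a
    -- non-empty block at position `N` carries `q ^ N`.
    rw [sum_piFinset_appendBlock, ← add_sum_erase _ _ (empty_mem_powerset univ), qEsymmSum_succ]
    congr 1
    · rw [← ih]
      refine sum_congr rfl fun B _ => ?_
      rw [ofFn_appendBlock]
      simp [nonemptyIndexSum_appendBlock]
    · simp only [nonemptyTuples, sum_piFinset_appendBlock, ofFn_appendBlock]
      rw [qEsymmSum_sum, mul_sum, powerset_univ]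
      refine sum_congr rfl fun S hS => ?_
      have hS : S.Nonempty := nonempty_iff_ne_empty.2 (ne_of_mem_erase hS)
      have := ih fun L => φ (L ++ [S])
      simp only [nonemptyTuples] at this
      rw [← this, mul_sum]
      refine sum_congr rfl fun B _ => ?_
      rw [nonemptyIndexSum_appendBlock, if_pos hS, List.filter_append, pow_add,
        List.filter_singleton, decide_eq_true hS, cond_true]
      ring

end EmptyBlocks

/-! ### The product formula for `dinv`. -/

section DiagonalInversions

variable {m : ℕ}

/-- The number of diagonal inversions of a list of blocks. -/
def dinvList : List (Finset (Fin (m + 1))) → ℕ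
  | [] => 0
  | S :: L => (L.map (pairDinv S)).sum + dinvList L

theorem dinv_eq_dinvList {k : ℕ} (B : Fin k → Finset (Fin (m + 1))) :
    dinv B = dinvList (List.ofFn B) := by
  induction k with
  | zero => simp [dinv_eq_sum, dinvList]
  | succ k ih =>
    rw [List.ofFn_succ, dinvList, ← ih, dinv_eq_sum, dinv_eq_sum, Fin.sum_univ_succ,
      List.map_ofFn, List.sum_ofFn]
    congr 1
    · rw [Fin.sum_univ_succ]
      simp
    · refine sum_congr rfl fun i _ => ?_
      rw [Fin.sum_univ_succ]
      simp

/-- Empty blocks have no entries to compare. Lists are convenient here because discarding blocks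
changes the length. -/
theorem dinvList_filter (L : List (Finset (Fin (m + 1)))) :
    dinvList (L.filter (·.Nonempty)) = dinvList L := by
  induction L with
  | nil => rfl
  | cons S L ih =>
    have h : ((L.filter (·.Nonempty)).map (pairDinv S)).sum = (L.map (pairDinv S)).sum := by
      clear ih
      induction L with
      | nil => rfl
      | cons T L ih =>
        rcases T.eq_empty_or_nonempty with rfl | hT
        · simpa [pairDinv] using ih
        · simpa [hT] using ih
    rcases S.eq_empty_or_nonempty with rfl | hS
    · have : pairDinv (∅ : Finset (Fin (m + 1))) = fun _ => 0 := by
        funext T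
        simp [pairDinv]
      simp [dinvList, ih, this]
    · rw [List.filter_cons_of_pos (by simpa using hS), dinvList, dinvList, h, ih]

variable {R : Type*} [CommRing R]

theorem weight_eq_prod_ofFn {α : Type*} {k : ℕ} (x : α → R) (B : Fin k → Finset α) :
    weight x B = ((List.ofFn B).map fun S => ∏ a ∈ S, x a).prod := by
  rw [weight, List.map_ofFn, List.prod_ofFn]
  rfl

theorem prod_map_filter_nonempty {α : Type*} (x : α → R) (L : List (Finset α)) :
    ((L.filter (·.Nonempty)).map fun S => ∏ a ∈ S, x a).prod =
      (L.map fun S => ∏ a ∈ S, x a).prod := by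
  induction L with
  | nil => rfl
  | cons T L ih =>
    rcases T.eq_empty_or_nonempty with rfl | hT
    · simpa using ih
    · simp [hT, ih]

/-- The generating function of a statistic over the sequences of `k + 1` non-empty blocks with
`0` not in the last block. -/
def extendedGF (q : R) (x : Fin (m + 1) → R)
    (stat : ∀ k, (Fin k → Finset (Fin (m + 1))) → ℕ) (k : ℕ) : R :=
  ∑ S ∈ (univ.erase 0).powerset.erase ∅, ∑ B ∈ nonemptyTuples (Fin (m + 1)) k,
    q ^ stat (k + 1) (appendBlock B S) * weight x (appendBlock B S)

/-- A block avoids `0` exactly when its minimum is non-zero, so the refined formula is summed over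
`c ≠ 0`. -/
theorem pow_mul_qEsymmSum_extendedGF {q : R} {stat : ∀ k, (Fin k → Finset (Fin (m + 1))) → ℕ}
    (h : HasLastMinFormula q stat) (x : Fin (m + 1) → R) (N : ℕ) :
    q ^ N * qEsymmSum q N (extendedGF q x stat) =
      boxProd q N x * (∏ a ∈ univ.erase 0, (1 + q ^ N * x a) - 1) := by
  have hU : ∀ c ∈ univ.erase (0 : Fin (m + 1)), ∀ a, c < a → a ∈ univ.erase 0 := by
    intro c _ a hca
    simpa using (Fin.pos_iff_ne_zero.1 (lt_of_le_of_lt (Fin.zero_le c) hca))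
  rw [← pow_mul_qEsymmSum_sum (h x N) _ hU]
  congr 2
  funext k
  rw [extendedGF, sum_powerset_erase_empty _ hU]
  refine sum_congr rfl fun c _ => ?_
  rw [lastMinGF, sum_comm]

theorem sum_appendBlock_dinv (q : R) (x : Fin (m + 1) → R) (N : ℕ) {S : Finset (Fin (m + 1))}
    (hS : S.Nonempty) :
    ∑ B ∈ Fintype.piFinset (fun _ : Fin N => (univ : Finset (Fin (m + 1))).powerset),
      q ^ (dinv (appendBlock B S) + nonemptyIndexSum (appendBlock B S)) *
        weight x (appendBlock B S) =
      q ^ N * qEsymmSum q N fun k => ∑ B ∈ nonemptyTuples (Fin (m + 1)) k,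
        q ^ dinv (appendBlock B S) * weight x (appendBlock B S) := by
  have := sum_nonemptyIndexSum q N fun L => q ^ dinvList (L ++ [S]) *
    ((L ++ [S]).map fun S => ∏ a ∈ S, x a).prod
  simp only [← ofFn_appendBlock, ← dinv_eq_dinvList, ← weight_eq_prod_ofFn] at this
  rw [← this, mul_sum]
  refine sum_congr rfl fun B _ => ?_
  have hf : (List.ofFn B).filter (·.Nonempty) ++ [S] =
      (List.ofFn (appendBlock B S)).filter (·.Nonempty) := by
    rw [ofFn_appendBlock, List.filter_append, List.filter_singleton, decide_eq_true hS, cond_true]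
  rw [hf, dinvList_filter, prod_map_filter_nonempty, ← dinv_eq_dinvList, ← weight_eq_prod_ofFn,
    nonemptyIndexSum_appendBlock, if_pos hS]
  ring

/-- Among `N + 1` possibly empty blocks with `0` barred from the last, the sequences with empty last
block contribute the unrestricted sum `boxProd q N x` for `N` blocks. Subtracting it leaves a
non-empty last block, which sits at position `N` and accounts for `q ^ N`. -/
theorem pow_mul_qEsymmSum_extendedGF_dinv (q : R) (x : Fin (m + 1) → R) (N : ℕ) :
    q ^ N * qEsymmSum q N (extendedGF q x fun _ => dinv) =
      boxProd q N x * (∏ a ∈ univ.erase 0, (1 + q ^ N * x a) - 1) := by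
  classical
  have hbox : boxProd q N x = (∏ p ∈ range N, (1 + q ^ p * x 0)) *
      ∏ a ∈ univ.erase 0, ∏ p ∈ range N, (1 + q ^ p * x a) :=
    (mul_prod_erase univ (fun a => ∏ p ∈ range N, (1 + q ^ p * x a)) (mem_univ 0)).symm
  have hall := sum_dinv_nonemptyIndexSum q x (univ : Finset (Fin N))
  simp only [mem_univ, implies_true, if_true] at hall
  rw [Fin.prod_univ_eq_prod_range fun p => 1 + q ^ p * x 0, ← hbox] at hall
  have hlast := sum_dinv_nonemptyIndexSum q x ((univ : Finset (Fin N)).map Fin.castSuccEmb)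
  rw [sum_piFinset_appendBlock, prod_map] at hlast
  simp only [Fin.coe_castSuccEmb, Fin.val_castSucc] at hlast
  rw [Fin.prod_univ_eq_prod_range fun p => 1 + q ^ p * x 0] at hlast
  simp only [prod_range_succ, prod_mul_distrib] at hlast
  rw [← mul_assoc, ← hbox] at hlast
  have hcond : ∀ (S : Finset (Fin (m + 1))) (B : Fin N → Finset (Fin (m + 1))),
      (∀ i, 0 ∈ appendBlock B S i → i ∈ (univ : Finset (Fin N)).map Fin.castSuccEmb) ↔ 0 ∉ S := by
    intro S B
    constructor
    · intro h h0
      simpa using h (Fin.last N) (by simpa using h0)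
    · intro h0 i hi
      induction i using Fin.lastCases with
      | last => simp [h0] at hi
      | cast i => simp
  simp only [hcond] at hlast
  have hfilter : ∀ f : Finset (Fin (m + 1)) → R,
      ∑ S ∈ (univ : Finset (Fin (m + 1))).powerset, (if 0 ∉ S then f S else 0) =
        f ∅ + ∑ S ∈ (univ.erase 0).powerset.erase ∅, f S := by
    intro f
    rw [add_sum_erase _ _ (empty_mem_powerset _), ← sum_filter]
    refine sum_congr ?_ fun _ _ => rfl
    ext S
    simp [subset_erase]
  have hlast' : ∑ S ∈ (univ : Finset (Fin (m + 1))).powerset, (if 0 ∉ S then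
      ∑ B ∈ Fintype.piFinset (fun _ : Fin N => (univ : Finset (Fin (m + 1))).powerset),
        q ^ (dinv (appendBlock B S) + nonemptyIndexSum (appendBlock B S)) *
        weight x (appendBlock B S) else 0) =
      boxProd q N x * ∏ a ∈ univ.erase 0, (1 + q ^ N * x a) := by
    rw [← hlast]
    refine sum_congr rfl fun S _ => ?_
    split_ifs <;> simp
  rw [hfilter] at hlast'
  have hempty : ∑ B ∈ Fintype.piFinset (fun _ : Fin N => (univ : Finset (Fin (m + 1))).powerset),
      q ^ (dinv (appendBlock B ∅) + nonemptyIndexSum (appendBlock B ∅)) *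
        weight x (appendBlock B ∅) = boxProd q N x := by
    rw [← hall]
    refine sum_congr rfl fun B _ => ?_
    have hd : dinv (appendBlock B ∅) = dinv B := by
      rw [dinv_eq_dinvList, ofFn_appendBlock, ← dinvList_filter, List.filter_append]
      simp [dinvList_filter, dinv_eq_dinvList]
    rw [hd, nonemptyIndexSum_appendBlock, weight_appendBlock]
    simp
  rw [hempty] at hlast'
  rw [mul_sub, mul_one, ← hlast', add_sub_cancel_left]
  have : extendedGF q x (fun _ => dinv) = fun k => ∑ S ∈ (univ.erase 0).powerset.erase ∅,
      ∑ B ∈ nonemptyTuples (Fin (m + 1)) k,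
        q ^ dinv (appendBlock B S) * weight x (appendBlock B S) := rfl
  rw [this, qEsymmSum_sum, mul_sum]
  refine sum_congr rfl fun S hS => ?_
  rw [sum_appendBlock_dinv q x N (nonempty_iff_ne_empty.2 (ne_of_mem_erase hS))]

end DiagonalInversions

/-! ### Extracting the coefficient of a given content. -/

section Coefficients

variable {m : ℕ}

-- The weight of a sequence is the monomial whose exponents are the letter multiplicities, so one
-- coefficient selects the sequences of content `content r β`.
open Polynomial in
theorem coeff_extendedGF (r : ℕ) (β : Fin m → ℕ)
    (stat : ∀ k, (Fin k → Finset (Fin (m + 1))) → ℕ) (k : ℕ) :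
    MvPolynomial.coeff (Finsupp.equivFunOnFinite.symm (content r β))
      (extendedGF (MvPolynomial.C (X : ℤ[X])) MvPolynomial.X stat k) =
      genFun (k := k + 1) r β (stat (k + 1)) := by
  have hw : ∀ B : Fin (k + 1) → Finset (Fin (m + 1)),
      weight (MvPolynomial.X : Fin (m + 1) → MvPolynomial (Fin (m + 1)) ℤ[X]) B =
        MvPolynomial.monomial
          (Finsupp.equivFunOnFinite.symm fun a => (univ.filter fun i => a ∈ B i).card) 1 := by
    intro B
    rw [MvPolynomial.monomial_eq, MvPolynomial.C_1, one_mul, Finsupp.prod_fintype _ _ (by simp)]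
    simp only [weight, Finsupp.equivFunOnFinite_symm_apply_apply]
    have : ∀ i, ∏ a ∈ B i, (MvPolynomial.X a : MvPolynomial (Fin (m + 1)) ℤ[X]) =
        ∏ a, if a ∈ B i then MvPolynomial.X a else 1 := fun i => by
      rw [← prod_filter, filter_mem_eq_inter, univ_inter]
    simp only [this]
    rw [prod_comm]
    refine prod_congr rfl fun a _ => ?_
    rw [← prod_const, prod_filter]
  have hs : extendedGF (MvPolynomial.C (X : ℤ[X])) MvPolynomial.X stat k =
      ∑ B ∈ Fintype.piFinset (fun _ : Fin (k + 1) =>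
        ((univ : Finset (Fin (m + 1))).powerset.erase ∅)), if 0 ∉ B (Fin.last k) then
          (MvPolynomial.C (X : ℤ[X])) ^ stat (k + 1) B * weight MvPolynomial.X B else 0 := by
    rw [sum_piFinset_appendBlock, extendedGF]
    simp only [Fin.snoc_last, powerset_univ]
    have : (univ.erase (0 : Fin (m + 1))).powerset.erase ∅ =
        (univ.erase ∅).filter fun S => 0 ∉ S := by
      ext S
      simp [subset_erase]
    rw [this, sum_filter]
    refine sum_congr rfl fun S _ => ?_
    split_ifs
    · simp
    · rfl
  rw [hs, MvPolynomial.coeff_sum, genFun, extendedOP, ← sum_filter_add_sum_filter_not _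
    (fun B => IsOrderedMultisetPartition (content r β) B ∧ 0 ∉ B (Fin.last k))]
  have hz : ∀ B ∈ (Fintype.piFinset (fun _ : Fin (k + 1) =>
      ((univ : Finset (Fin (m + 1))).powerset.erase ∅))).filter
      (fun B => ¬ (IsOrderedMultisetPartition (content r β) B ∧ 0 ∉ B (Fin.last k))),
      MvPolynomial.coeff (Finsupp.equivFunOnFinite.symm (content r β)) (if 0 ∉ B (Fin.last k) then
          (MvPolynomial.C (X : ℤ[X])) ^ stat (k + 1) B * weight MvPolynomial.X B else 0) = 0 := by
    intro B hB
    rw [mem_filter, Fintype.mem_piFinset] at hB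
    by_cases h0 : 0 ∈ B (Fin.last k)
    · rw [if_neg (not_not.2 h0), MvPolynomial.coeff_zero]
    · rw [if_pos h0, hw, ← MvPolynomial.C_pow, MvPolynomial.coeff_C_mul,
        MvPolynomial.coeff_monomial, if_neg, mul_zero]
      intro he
      refine hB.2 ⟨⟨fun i => nonempty_iff_ne_empty.2 (ne_of_mem_erase (hB.1 i)), fun a => ?_⟩, h0⟩
      exact congrFun (Finsupp.equivFunOnFinite.symm.injective he) a
  rw [sum_eq_zero hz, add_zero]
  refine sum_congr ?_ fun B hB => ?_
  · ext B
    simp only [mem_filter, Fintype.mem_piFinset, mem_univ, true_and, powerset_univ, mem_erase,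
      and_true]
    constructor
    · rintro ⟨_, h₁, h₂⟩
      refine ⟨h₁, fun i hi => ?_⟩
      rwa [show i = Fin.last k from Fin.ext (by simpa using hi)]
    · rintro ⟨h₁, h₂⟩
      exact ⟨fun i => (h₁.1 i).ne_empty, h₁, h₂ _ (by simp)⟩
  · simp only [mem_filter, mem_univ, true_and] at hB
    rw [if_pos (hB.2 _ (by simp)), hw, ← MvPolynomial.C_pow, MvPolynomial.coeff_C_mul,
      MvPolynomial.coeff_monomial, if_pos, mul_one]
    congr 1
    exact funext hB.1.2

open Polynomial in
/-- Equidistribution of two statistics with the same generating function identities. -/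
theorem genFun_eq_of_qEsymmSum_eq (r : ℕ) (β : Fin m → ℕ)
    {stat stat' : ∀ k, (Fin k → Finset (Fin (m + 1))) → ℕ}
    (h : ∀ N, (MvPolynomial.C (X : ℤ[X]) : MvPolynomial (Fin (m + 1)) ℤ[X]) ^ N *
        qEsymmSum (MvPolynomial.C X) N (extendedGF (MvPolynomial.C X) MvPolynomial.X stat) =
      MvPolynomial.C X ^ N *
        qEsymmSum (MvPolynomial.C X) N (extendedGF (MvPolynomial.C X) MvPolynomial.X stat'))
    (h0 : ∀ B, stat 0 B = 0) (h0' : ∀ B, stat' 0 B = 0) (k : ℕ) :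
    genFun (k := k) r β (stat k) = genFun (k := k) r β (stat' k) := by
  cases k with
  -- `extendedGF` only covers sequences with a last block, so `k = 0` is settled by the values on
  -- the empty sequence.
  | zero => simp [genFun, h0, h0']
  | succ k =>
    have hX : (MvPolynomial.C (X : ℤ[X]) : MvPolynomial (Fin (m + 1)) ℤ[X]) ≠ 0 := by
      simp
    rw [← coeff_extendedGF, ← coeff_extendedGF,
      eq_of_qEsymmSum_eq hX fun N => mul_left_cancel₀ (pow_ne_zero N hX) (h N)]

end Coefficients

end OMP

theorem mainTheorem2 (r k m : ℕ) (β : Fin m → ℕ) :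
    OMP.genFun (k := k) r β OMP.inv = OMP.genFun (k := k) r β OMP.maj ∧
    OMP.genFun (k := k) r β OMP.maj = OMP.genFun (k := k) r β OMP.dinv ∧
    OMP.genFun (k := k) r β OMP.dinv = OMP.genFun (k := k) r β OMP.minimaj := by
  have hinv : ∀ B : Fin 0 → Finset (Fin (m + 1)), OMP.inv B = 0 := fun B => by
    simp [OMP.inv_eq_sum]
  have hmaj : ∀ B : Fin 0 → Finset (Fin (m + 1)), OMP.maj B = 0 := fun B => by
    simp [OMP.maj, OMP.sigmaWord]
  have hdinv : ∀ B : Fin 0 → Finset (Fin (m + 1)), OMP.dinv B = 0 := fun B => by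
    simp [OMP.dinv_eq_sum]
  have hminimaj : ∀ B : Fin 0 → Finset (Fin (m + 1)), OMP.minimaj B = 0 := fun B => by
    simp [OMP.minimaj, OMP.miniword, OMP.miniwordList, OMP.wordMaj]
  refine ⟨OMP.genFun_eq_of_qEsymmSum_eq r β (stat := fun _ => OMP.inv)
      (stat' := fun _ => OMP.maj) (fun N => ?_) hinv hmaj k,
    OMP.genFun_eq_of_qEsymmSum_eq r β (stat := fun _ => OMP.maj)
      (stat' := fun _ => OMP.dinv) (fun N => ?_) hmaj hdinv k,
    OMP.genFun_eq_of_qEsymmSum_eq r β (stat := fun _ => OMP.dinv)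
      (stat' := fun _ => OMP.minimaj) (fun N => ?_) hdinv hminimaj k⟩
  · rw [OMP.pow_mul_qEsymmSum_extendedGF (OMP.hasLastMinFormula_inv _),
      OMP.pow_mul_qEsymmSum_extendedGF (OMP.hasLastMinFormula_maj _)]
  · rw [OMP.pow_mul_qEsymmSum_extendedGF (OMP.hasLastMinFormula_maj _),
      OMP.pow_mul_qEsymmSum_extendedGF_dinv]
  · rw [OMP.pow_mul_qEsymmSum_extendedGF_dinv,
      OMP.pow_mul_qEsymmSum_extendedGF (OMP.hasLastMinFormula_minimaj _)]
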